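/- Let $\mathbb K$ be a field and let $E=(E^0,E^1,r,s)$ be a directed graph (with range and source maps $r,s:E^1\to E^0$) that has at least one edge. Let $\mathbb F$ be the free group on $E^1$, with identity $e$. Let $L_{\mathbb K}(E)$ be the Leavitt path algebra, that is, the (not necessarily unital) associative $\mathbb K$-algebra generated by pairwise orthogonal idempotents $v\in E^0$ and elements $f,f^*$ ($f\in E^1$) subject to $s(f)f=fr(f)=f$, $r(f)f^*=f^*s(f)=f^*$, $f^*f'=\delta_{f,f'}r(f)$ for $f,f'\in E^1$, and $v=\sum_{s(f)=v}ff^*$ whenever $s^{-1}(v)$ is finite and non-empty. Let $W$ be the set of finite paths of non-zero length, and let $X$ be the set of all finite paths ending in a sink (including sinks themselves, as paths of length zero) and all infinite paths. For $g\in\mathbb F$ define $X_g\subseteq X$ by: $X_e=X$; $X_{b^{-1}}=\{\xi\in X: s(\xi)=r(b)\}$ for $b\in W$; $X_a=\{\xi\in X:\xi\text{ begins with }a\}$ for $a\in W$; $X_{ab^{-1}}=X_a$ for $a,b\in W$ with $r(a)=r(b)$ and $ab^{-1}$ reduced; $X_g=\emptyset$ for all other $g$. Let $\theta_g:X_{g^{-1}}\to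 X_g$ be the bijection $b\zeta\mapsto a\zeta$ when $g=ab^{-1}$ in reduced form, where $a$ or $b$ may have length zero (so that $\theta_e=\mathrm{id}$). Let $1_g$ and $1_v$ be the $\mathbb K$-valued characteristic functions on $X$ of $X_g$ and of $X_v=\{\xi\in X:s(\xi)=v\}$, let $D(X)$ be the $\mathbb K$-linear span of $\{1_g: g\in\mathbb F\setminus\{e\}\}\cup\{1_v:v\in E^0\}$, let $D_e=D(X)$ and $D_g=1_gD(X)$ for $g\ne e$, and let $\alpha_g:D_{g^{-1}}\to D_g$, $\alpha_g(h)=h\circ\theta_{g^{-1}}$ on $X_g$ (and $0$ off $X_g$). Then $\alpha=(D_g,\alpha_g)_{g\in\mathbb F}$ is a partial action of $\mathbb F$ on $D(X)$; let $D(X)\star_\alpha\mathbb F=\bigoplus_{g\in\mathbb F}D_g\delta_g$ be its partial skew group ring, with product $(x\delta_g)(y\delta_h)=\alpha_g(\alpha_{g^{-1}}(x)y)\delta_{gh}$. There is a unique isomorphism of $\mathbb K$-algebras $\varphi:L_{\mathbb K}(E)\to D(X)\star_\alpha\mathbb F$ with $\varphi(f)=1_f\delta_f$, $\varphi(f^*)=1_{f^{-1}}\delta_{f^{-1}}$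 for $f\in E^1$ and $\varphi(v)=1_v\delta_e$ for $v\in E^0$, and $L_{\mathbb K}(E)_g:=\varphi^{-1}(D_g\delta_g)$, $g\in\mathbb F$, is an $\mathbb F$-grading of $L_{\mathbb K}(E)$. For this grading the following assertions are equivalent: 1. $L_{\mathbb K}(E)$ is strongly graded, i.e. $L_{\mathbb K}(E)_g\,L_{\mathbb K}(E)_h=L_{\mathbb K}(E)_{gh}$ for all $g,h\in\mathbb F$, where the left side is the set of finite sums of products; 2. $L_{\mathbb K}(E)$ is graded clean, i.e. it is unital and every homogeneous element is the sum of a homogeneous unit and a homogeneous idempotent ($0$ being allowed as an idempotent); 3. $L_{\mathbb K}(E)$ is graded unit-regular, i.e. it is unital and every homogeneous element $x$ can be written as $x=xux$ with a homogeneous unit $u$; 4. $E$ consists of exactly one vertex and exactly one edge (a loop at that vertex). -/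

import Mathlib

universe u v w

/-! ### Graded rings (not assumed to be unital) -/

namespace GroupGraded

variable {G : Type*} {R : Type*} [Group G] [NonUnitalRing R]

open Classical in
/-- `R = ⨁ R_g` with `R_g R_h ⊆ R_{gh}`. -/
structure IsGrading (A : G → AddSubgroup R) : Prop where
  internal : DirectSum.IsInternal A
  mul_mem : ∀ (g h : G) (x y : R), x ∈ A g → y ∈ A h → x * y ∈ A (g * h)

/-- The grading is strong: `R_g R_h = R_{gh}`, where `R_g R_h` is the set of finite sums of
products. -/
def IsStronglyGraded (A : G → AddSubgroup R) : Prop :=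
  IsGrading A ∧
    ∀ g h : G, AddSubgroup.closure {z : R | ∃ x ∈ A g, ∃ y ∈ A h, z = x * y} = A (g * h)

/-- `e` is the (two-sided) unit of `R`. -/
def IsUnity (e : R) : Prop := ∀ x : R, e * x = x ∧ x * e = x

/-- `u` is invertible with respect to the unit `e`. -/
def IsInvertible (e u : R) : Prop := ∃ w : R, u * w = e ∧ w * u = e

/-- `x` lies in one of the components (`0` is allowed). -/
def IsHomogeneous (A : G → AddSubgroup R) (x : R) : Prop := ∃ g : G, x ∈ A g

/-- `R` is unital, and every homogeneous element is the sum of a homogeneous unit and a homogeneous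
idempotent. -/
def IsGradedClean (A : G → AddSubgroup R) : Prop :=
  IsGrading A ∧ ∃ e : R, IsUnity e ∧ ∀ x : R, IsHomogeneous A x →
    ∃ u a : R, IsHomogeneous A u ∧ IsInvertible e u ∧ IsHomogeneous A a ∧ a * a = a ∧ x = u + a

/-- `R` is unital, and every homogeneous `x` is `x u x` for some homogeneous unit `u`. -/
def IsGradedUnitRegular (A : G → AddSubgroup R) : Prop :=
  IsGrading A ∧ ∃ e : R, IsUnity e ∧ ∀ x : R, IsHomogeneous A x →
    ∃ u : R, IsHomogeneous A u ∧ IsInvertible e u ∧ x = x * u * x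

end GroupGraded

/-! ### Partial actions and partial skew group rings -/

/-- A partial action of the group `G` on the `K`-algebra `R`: ideals `D g` and isomorphisms of
`K`-algebras `α g : D g⁻¹ → D g`. -/
structure PartialAction (K : Type*) (G : Type*) (R : Type*) [CommRing K] [Group G]
    [NonUnitalRing R] [Module K R] where
  D : G → Submodule K R
  mul_mem_left : ∀ (g : G) (r x : R), x ∈ D g → r * x ∈ D g
  mul_mem_right : ∀ (g : G) (r x : R), x ∈ D g → x * r ∈ D g
  α : ∀ g : G, D g⁻¹ ≃ₗ[K] D g
  map_mul : ∀ (g : G) (x y : D g⁻¹),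
    (α g ⟨(x : R) * y, mul_mem_left _ _ _ y.2⟩ : R) = (α g x : R) * (α g y : R)
  D_one : D 1 = ⊤
  α_one : ∀ x : D (1 : G)⁻¹, (α 1 x : R) = x
  image_inter : ∀ g h : G,
    (fun x : D g⁻¹ => (α g x : R)) '' {x | (x : R) ∈ D h} = {y : R | y ∈ D g ∧ y ∈ D (g * h)}
  comp : ∀ (g h : G) (r : R) (hr : r ∈ D h⁻¹) (hr' : r ∈ D (g * h)⁻¹)
    (hm : (α h ⟨r, hr⟩ : R) ∈ D g⁻¹), (α g ⟨_, hm⟩ : R) = α (g * h) ⟨r, hr'⟩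

namespace PartialAction

variable {K : Type*} {G : Type*} {R : Type*} [CommRing K] [Group G]
  [NonUnitalRing R] [Module K R]

/-- An element of `D g`, regarded as an element of `D (g⁻¹)⁻¹`. -/
def toInvInv (P : PartialAction K G R) (g : G) : P.D g →ₗ[K] P.D (g⁻¹)⁻¹ :=
  Submodule.inclusion (by rw [inv_inv])

/-- The element `α_{g⁻¹}(r) r'` of `D g⁻¹ ∩ D h`, for `r ∈ D g` and `r' ∈ D h`. -/
def coeffArg (P : PartialAction K G R) (g h : G) (r : P.D g) (r' : P.D h) : P.D g⁻¹ :=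
  ⟨(P.α g⁻¹ (P.toInvInv g r) : R) * r', P.mul_mem_right _ _ _ (P.α g⁻¹ _).2⟩

/-- The coefficient `α_g (α_{g⁻¹}(r) r')` of `(r δ_g) (r' δ_h)`. -/
def coeffMul (P : PartialAction K G R) (g h : G) (r : P.D g) (r' : P.D h) : R :=
  P.α g (P.coeffArg g h r r')

theorem coeffMul_mem (P : PartialAction K G R) (g h : G) (r : P.D g) (r' : P.D h) :
    P.coeffMul g h r r' ∈ P.D (g * h) := by
  have : P.coeffMul g h r r' ∈
      (fun x : P.D g⁻¹ => (P.α g x : R)) '' {x | (x : R) ∈ P.D h} :=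
    ⟨P.coeffArg g h r r', P.mul_mem_left _ _ _ r'.2, rfl⟩
  rw [P.image_inter] at this
  exact this.2

variable [IsScalarTower K R R] [SMulCommClass K R R]

/-- The bilinear map `D g × D h → D (g h)` underlying the product of the partial skew group
ring. -/
def mulComponent (P : PartialAction K G R) (g h : G) : P.D g →ₗ[K] P.D h →ₗ[K] P.D (g * h) :=
  LinearMap.mk₂ K (fun r r' => ⟨P.coeffMul g h r r', P.coeffMul_mem g h r r'⟩)
    (fun a b c => by
      have : P.coeffArg g h (a + b) c = P.coeffArg g h a c + P.coeffArg g h b c :=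
        Subtype.ext (by simp [coeffArg, add_mul])
      exact Subtype.ext (by simp [coeffMul, this]))
    (fun k a c => by
      have : P.coeffArg g h (k • a) c = k • P.coeffArg g h a c :=
        Subtype.ext (by simp [coeffArg, smul_mul_assoc])
      exact Subtype.ext (by simp [coeffMul, this]))
    (fun a b c => by
      have : P.coeffArg g h a (b + c) = P.coeffArg g h a b + P.coeffArg g h a c :=
        Subtype.ext (by simp [coeffArg, mul_add])
      exact Subtype.ext (by simp [coeffMul, this]))
    (fun k a c => by
      have : P.coeffArg g h a (k • c) = k • P.coeffArg g h a c :=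
        Subtype.ext (by simp [coeffArg, mul_smul_comm])
      exact Subtype.ext (by simp [coeffMul, this]))

open DirectSum in
/-- The partial skew group ring: the direct sum of the `D g δ_g`. -/
def SkewGroupRing (P : PartialAction K G R) : Type _ := ⨁ g : G, P.D g

namespace SkewGroupRing

variable (P : PartialAction K G R)

noncomputable instance : AddCommGroup P.SkewGroupRing :=
  inferInstanceAs (AddCommGroup (DirectSum G fun g => P.D g))

noncomputable instance : Module K P.SkewGroupRing :=
  inferInstanceAs (Module K (DirectSum G fun g => P.D g))

open Classical in
/-- The element `r δ_g`, for `r ∈ D g`. -/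
noncomputable def single (g : G) : P.D g →ₗ[K] P.SkewGroupRing :=
  DirectSum.lof K G (fun g => P.D g) g

open Classical in
/-- The bilinear extension of `(r δ_g) (r' δ_h) = α_g (α_{g⁻¹}(r) r') δ_{gh}`. -/
noncomputable def mulMap : P.SkewGroupRing →ₗ[K] P.SkewGroupRing →ₗ[K] P.SkewGroupRing :=
  DirectSum.toModule K G _ fun g =>
    LinearMap.flip <| DirectSum.toModule K G _ fun h =>
      LinearMap.flip <| (P.mulComponent g h).compr₂ (single P (g * h))

noncomputable instance : Mul P.SkewGroupRing := ⟨fun a b => mulMap P a b⟩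

theorem mul_def (a b : P.SkewGroupRing) : a * b = mulMap P a b := rfl

noncomputable instance : NonUnitalNonAssocRing P.SkewGroupRing where
  left_distrib a b c := by simp only [mul_def, map_add]
  right_distrib a b c := by simp only [mul_def, map_add, LinearMap.add_apply]
  zero_mul a := by simp only [mul_def, map_zero, LinearMap.zero_apply]
  mul_zero a := by simp only [mul_def, map_zero]

theorem single_mul_single (g h : G) (r : P.D g) (r' : P.D h) :
    single P g r * single P h r' =
      single P (g * h) ⟨P.coeffMul g h r r', P.coeffMul_mem g h r r'⟩ := by
  classical
  simp only [mul_def, mulMap]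
  erw [DirectSum.toModule_lof, LinearMap.flip_apply, DirectSum.toModule_lof]
  rfl

/-- The homogeneous component `D g δ_g`. -/
noncomputable def component (g : G) : Submodule K P.SkewGroupRing := LinearMap.range (single P g)

end SkewGroupRing

end PartialAction

/-! ### Directed graphs and Leavitt path algebras -/

/-- A directed graph with vertex set `V`, edge set `E`, source map `s` and range map `r`. -/
structure DirectedGraph (V : Type u) (E : Type v) where
  s : E → V
  r : E → V

namespace DirectedGraph

variable {V : Type u} {E : Type v}

/-- The graph consists of a single vertex and a single loop. -/
def IsLoop (Γ : DirectedGraph V E) : Prop :=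
  ∃ (x : V) (e : E), (∀ y : V, y = x) ∧ (∀ f : E, f = e) ∧ Γ.s e = x ∧ Γ.r e = x

/-- A vertex that emits no edge. -/
def IsSink (Γ : DirectedGraph V E) (x : V) : Prop := ∀ f : E, Γ.s f ≠ x

/-- The generators of the Leavitt path algebra: vertices, edges and ghost edges. -/
inductive Gen (V : Type u) (E : Type v) : Type (max u v)
  | vertex : V → Gen V E
  | edge : E → Gen V E
  | ghost : E → Gen V E

/-- The free (associative, non-unital) `K`-algebra on the generators: the semigroup algebra of the
free semigroup. -/
abbrev FreeAlg (K : Type w) [Field K] (V : Type u) (E : Type v) : Type (max u v w) :=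
  MonoidAlgebra K (FreeSemigroup (Gen V E))

/-- A generator, as an element of the free algebra. -/
noncomputable def gen (K : Type w) [Field K] (x : Gen V E) : FreeAlg K V E :=
  MonoidAlgebra.single (FreeSemigroup.of x) 1

open Gen in
/-- The defining relations of the Leavitt path algebra. -/
inductive LeavittRel (K : Type w) [Field K] (Γ : DirectedGraph V E) :
    FreeAlg K V E → FreeAlg K V E → Prop
  | vertex_idem (x : V) :
      LeavittRel K Γ (gen K (vertex x) * gen K (vertex x)) (gen K (vertex x))
  | vertex_orth (x y : V) : x ≠ y →
      LeavittRel K Γ (gen K (vertex x) * gen K (vertex y)) 0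
  | source_edge (f : E) :
      LeavittRel K Γ (gen K (vertex (Γ.s f)) * gen K (edge f)) (gen K (edge f))
  | edge_range (f : E) :
      LeavittRel K Γ (gen K (edge f) * gen K (vertex (Γ.r f))) (gen K (edge f))
  | range_ghost (f : E) :
      LeavittRel K Γ (gen K (vertex (Γ.r f)) * gen K (ghost f)) (gen K (ghost f))
  | ghost_source (f : E) :
      LeavittRel K Γ (gen K (ghost f) * gen K (vertex (Γ.s f))) (gen K (ghost f))
  | ghost_edge (f : E) :
      LeavittRel K Γ (gen K (ghost f) * gen K (edge f)) (gen K (vertex (Γ.r f)))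
  | ghost_edge_ne (f f' : E) : f ≠ f' →
      LeavittRel K Γ (gen K (ghost f) * gen K (edge f')) 0
  | sum_edges (x : V) (F : Finset E) : F.Nonempty → (∀ f : E, f ∈ F ↔ Γ.s f = x) →
      LeavittRel K Γ (gen K (vertex x)) (∑ f ∈ F, gen K (edge f) * gen K (ghost f))

/-- The scalar multiples of the relations. The ring congruence that they generate is compatible
with scalars, and so it is the congruence of `K`-algebras generated by the relations. -/
def LeavittRelSMul (K : Type w) [Field K] (Γ : DirectedGraph V E) (a b : FreeAlg K V E) : Prop :=
  ∃ (k : K) (a' b' : FreeAlg K V E), LeavittRel K Γ a' b' ∧ a = k • a' ∧ b = k • b'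

/-- The congruence on the free algebra generated by the defining relations. -/
noncomputable def leavittCon (K : Type w) [Field K] (Γ : DirectedGraph V E) : RingCon (FreeAlg K V E) :=
  ringConGen (LeavittRelSMul K Γ)

theorem leavittCon_smul (K : Type w) [Field K] (Γ : DirectedGraph V E) (k : K)
    {a b : FreeAlg K V E} (h : leavittCon K Γ a b) : leavittCon K Γ (k • a) (k • b) := by
  have h' : RingConGen.Rel (LeavittRelSMul K Γ) a b := h
  show RingConGen.Rel (LeavittRelSMul K Γ) (k • a) (k • b)
  clear h
  induction h' with
  | of x y hxy =>
    obtain ⟨l, a', b', hab, rfl, rfl⟩ := hxy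
    exact .of _ _ ⟨k * l, a', b', hab, by rw [mul_smul], by rw [mul_smul]⟩
  | refl x => exact .refl _
  | symm h ih => exact .symm ih
  | trans h₁ h₂ ih₁ ih₂ => exact .trans ih₁ ih₂
  | add h₁ h₂ ih₁ ih₂ => rw [smul_add, smul_add]; exact .add ih₁ ih₂
  | mul h₁ h₂ ih₁ ih₂ =>
    rw [← smul_mul_assoc, ← smul_mul_assoc]; exact .mul ih₁ h₂

/-- The Leavitt path algebra of the graph with coefficients in `K`. It is not assumed to have a
unit. -/
def LeavittPathAlgebra (K : Type w) [Field K] (Γ : DirectedGraph V E) : Type (max u v w) :=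
  (leavittCon K Γ).Quotient

namespace LeavittPathAlgebra

variable (K : Type w) [Field K] (Γ : DirectedGraph V E)

noncomputable instance : NonUnitalRing (LeavittPathAlgebra K Γ) :=
  inferInstanceAs (NonUnitalRing (leavittCon K Γ).Quotient)

/-- The quotient map from the free algebra. -/
noncomputable def mk (a : FreeAlg K V E) : LeavittPathAlgebra K Γ := (a : (leavittCon K Γ).Quotient)

theorem mk_surjective : Function.Surjective (mk K Γ) := Quotient.mk''_surjective

theorem mk_add (a b : FreeAlg K V E) : mk K Γ (a + b) = mk K Γ a + mk K Γ b := rfl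

theorem mk_mul (a b : FreeAlg K V E) : mk K Γ (a * b) = mk K Γ a * mk K Γ b := rfl

theorem mk_zero : mk K Γ 0 = 0 := rfl

theorem mk_eq {a b : FreeAlg K V E} : mk K Γ a = mk K Γ b ↔ leavittCon K Γ a b :=
  RingCon.eq (leavittCon K Γ)

noncomputable instance : SMul K (LeavittPathAlgebra K Γ) :=
  ⟨fun k => Quotient.map' (k • ·) fun _ _ h => leavittCon_smul K Γ k h⟩

theorem mk_smul (k : K) (a : FreeAlg K V E) : mk K Γ (k • a) = k • mk K Γ a := rfl

noncomputable instance : Module K (LeavittPathAlgebra K Γ) :=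
  Function.Surjective.module K
    ({ toFun := mk K Γ, map_zero' := rfl, map_add' := fun _ _ => rfl } :
      FreeAlg K V E →+ LeavittPathAlgebra K Γ)
    (mk_surjective K Γ) (fun _ _ => rfl)

/-- The generator `v`, for a vertex `v`. -/
noncomputable def vertex (x : V) : LeavittPathAlgebra K Γ := mk K Γ (gen K (Gen.vertex x))

/-- The generator `f`, for an edge `f`. -/
noncomputable def edge (f : E) : LeavittPathAlgebra K Γ := mk K Γ (gen K (Gen.edge f))

/-- The generator `f*`, for an edge `f`. -/
noncomputable def ghost (f : E) : LeavittPathAlgebra K Γ := mk K Γ (gen K (Gen.ghost f))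

end LeavittPathAlgebra

/-! ### Paths and the partial action of the free group on the set `X` -/

/-- The list of edges `a` is a path from the vertex `x` to the vertex `y`; the empty list is the
path of length zero at `x`. -/
def IsPath (Γ : DirectedGraph V E) : V → List E → V → Prop
  | x, [], y => x = y
  | x, f :: a, y => Γ.s f = x ∧ IsPath Γ (Γ.r f) a y

/-- The set `X`: the finite paths that end in a sink (a sink itself is such a path, of length zero),
and the infinite paths. -/
inductive BoundaryPath (Γ : DirectedGraph V E) : Type (max u v)
  | finite (x : V) (a : List E) (h : ∃ y : V, Γ.IsSink y ∧ Γ.IsPath x a y) : BoundaryPath Γ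
  | infinite (p : ℕ → E) (h : ∀ i : ℕ, Γ.r (p i) = Γ.s (p (i + 1))) : BoundaryPath Γ

namespace BoundaryPath

variable {Γ : DirectedGraph V E}

/-- The source of a path in `X`. -/
def source : BoundaryPath Γ → V
  | finite x _ _ => x
  | infinite p _ => Γ.s (p 0)

/-- The path `f ξ`, for an edge `f` and a path `ξ` with `s(ξ) = r(f)`. -/
def cons (f : E) : (ξ : BoundaryPath Γ) → Γ.r f = ξ.source → BoundaryPath Γ
  | finite _ a h, hf =>
    finite (Γ.s f) (f :: a) (h.imp fun _ hy => ⟨hy.1, rfl, by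
      have hf' : Γ.r f = _ := hf
      rw [hf']; exact hy.2⟩)
  | infinite p h, hf =>
    infinite (fun n => Nat.casesOn n f p) (fun i => by
      cases i with
      | zero => exact hf
      | succ i => exact h i)

/-- `η = f ξ`. -/
def IsCons (f : E) (ξ η : BoundaryPath Γ) : Prop := ∃ h : Γ.r f = ξ.source, η = cons f ξ h

/-- `η = a ξ`, for a list of edges `a`; this entails that `a` is a path with `r(a) = s(ξ)`. -/
def IsConcat : List E → BoundaryPath Γ → BoundaryPath Γ → Prop
  | [], ξ, η => η = ξ
  | f :: a, ξ, η => ∃ ζ, IsConcat a ξ ζ ∧ IsCons f ζ η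

/-- The path `ξ` begins with the path `a`. -/
def BeginsWith (ξ : BoundaryPath Γ) (a : List E) : Prop := ∃ ζ, IsConcat a ζ ξ

end BoundaryPath

/-- The word `a b⁻¹` in the letters `f`, `f⁻¹`. -/
def pathWord (a b : List E) : List (E × Bool) :=
  a.map (fun f => (f, true)) ++ FreeGroup.invRev (b.map fun f => (f, true))

/-- The set `X_g`, for an element `g` of the free group on the edges. -/
def domain (Γ : DirectedGraph V E) (g : FreeGroup E) : Set (BoundaryPath Γ) :=
  {ξ | g = 1 ∨
    (∃ x b y, b ≠ [] ∧ Γ.IsPath x b y ∧ g = FreeGroup.mk (pathWord [] b) ∧ ξ.source = y) ∨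
    (∃ x a y, a ≠ [] ∧ Γ.IsPath x a y ∧ g = FreeGroup.mk (pathWord a []) ∧ ξ.BeginsWith a) ∨
    (∃ x a x' b y, a ≠ [] ∧ b ≠ [] ∧ Γ.IsPath x a y ∧ Γ.IsPath x' b y ∧
      FreeGroup.IsReduced (pathWord a b) ∧ g = FreeGroup.mk (pathWord a b) ∧ ξ.BeginsWith a)}

/-- `θ_g(ξ) = η`, as a relation: `ξ = b ζ` and `η = a ζ`, where `g = a b⁻¹` is in reduced form.
Here `a` and `b` may have length zero, which covers `g = 1`, `g = a` and `g = b⁻¹`. -/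
def Theta (Γ : DirectedGraph V E) (g : FreeGroup E) (ξ η : BoundaryPath Γ) : Prop :=
  ∃ (a b : List E) (ζ : BoundaryPath Γ), FreeGroup.IsReduced (pathWord a b) ∧
    g = FreeGroup.mk (pathWord a b) ∧ BoundaryPath.IsConcat b ζ ξ ∧ BoundaryPath.IsConcat a ζ η

section PathLemmas

variable {Γ : DirectedGraph V E}

open BoundaryPath

theorem IsPath.unique {x y y' : V} {a : List E} (h : Γ.IsPath x a y) (h' : Γ.IsPath x a y') :
    y = y' := by
  induction a generalizing x with
  | nil => exact Eq.trans (Eq.symm h) h'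
  | cons f a ih => exact ih h.2 h'.2

theorem IsPath.eq_of_ne_nil {x x' y y' : V} {a : List E} (ha : a ≠ []) (h : Γ.IsPath x a y)
    (h' : Γ.IsPath x' a y') : x = x' ∧ y = y' := by
  cases a with
  | nil => exact absurd rfl ha
  | cons f a => exact ⟨h.1.symm.trans h'.1, h.2.unique h'.2⟩

theorem BoundaryPath.source_cons (f : E) (ξ : BoundaryPath Γ) (h : Γ.r f = ξ.source) :
    (cons f ξ h).source = Γ.s f := by
  cases ξ <;> rfl

theorem BoundaryPath.IsCons.inj {f f' : E} {ζ ζ' η : BoundaryPath Γ} (h : IsCons f ζ η)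
    (h' : IsCons f' ζ' η) : f = f' ∧ ζ = ζ' := by
  obtain ⟨h, rfl⟩ := h
  obtain ⟨h', e⟩ := h'
  cases ζ with
  | finite x a hx =>
    cases ζ' with
    | finite x' a' hx' =>
      simp only [cons, finite.injEq, List.cons.injEq] at e
      obtain ⟨-, rfl, rfl⟩ := e
      have : x = x' := Eq.trans (Eq.symm h) h'
      subst this
      exact ⟨rfl, rfl⟩
    | infinite p' hp' => simp [cons] at e
  | infinite p hp =>
    cases ζ' with
    | finite x' a' hx' => simp [cons] at e
    | infinite p' hp' =>
      simp only [cons, infinite.injEq] at e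
      have h0 : f = f' := congrFun e 0
      have h1 : p = p' := funext fun n => congrFun e (n + 1)
      subst h0 h1
      exact ⟨rfl, rfl⟩

theorem BoundaryPath.IsCons.unique {f : E} {ζ η η' : BoundaryPath Γ} (h : IsCons f ζ η)
    (h' : IsCons f ζ η') : η = η' := by
  obtain ⟨h, rfl⟩ := h
  obtain ⟨h', rfl⟩ := h'
  rfl

theorem BoundaryPath.IsConcat.isPath {a : List E} {ζ η : BoundaryPath Γ} (h : IsConcat a ζ η) :
    Γ.IsPath η.source a ζ.source := by
  induction a generalizing η with
  | nil => cases h; exact rfl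
  | cons f a ih =>
    obtain ⟨μ, h₁, h₂, rfl⟩ := h
    refine ⟨(source_cons f μ h₂).symm, ?_⟩
    rw [h₂]
    exact ih h₁

theorem BoundaryPath.exists_isConcat {a : List E} {x : V} {ζ : BoundaryPath Γ}
    (h : Γ.IsPath x a ζ.source) : ∃ η, IsConcat a ζ η ∧ η.source = x := by
  induction a generalizing x with
  | nil => exact ⟨ζ, rfl, Eq.symm h⟩
  | cons f a ih =>
    obtain ⟨μ, h₁, h₂⟩ := ih h.2
    exact ⟨cons f μ h₂.symm, ⟨μ, h₁, h₂.symm, rfl⟩, (source_cons _ _ _).trans h.1⟩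

theorem BoundaryPath.isConcat_append {a c : List E} {ζ ξ : BoundaryPath Γ} :
    IsConcat (a ++ c) ζ ξ ↔ ∃ ζ', IsConcat c ζ ζ' ∧ IsConcat a ζ' ξ := by
  induction a generalizing ξ with
  | nil => simp [IsConcat]
  | cons f a ih =>
    simp only [List.cons_append, IsConcat, ih]
    constructor
    · rintro ⟨μ, ⟨ν, h₁, h₂⟩, h₃⟩; exact ⟨ν, h₁, μ, h₂, h₃⟩
    · rintro ⟨ν, h₁, μ, h₂, h₃⟩; exact ⟨μ, ⟨ν, h₁, h₂⟩, h₃⟩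

theorem BoundaryPath.BeginsWith.prefix {a b : List E} {ξ : BoundaryPath Γ} (h : ξ.BeginsWith b)
    (hab : a <+: b) : ξ.BeginsWith a := by
  obtain ⟨c, rfl⟩ := hab
  obtain ⟨ζ, h⟩ := h
  obtain ⟨ζ', -, h'⟩ := isConcat_append.1 h
  exact ⟨ζ', h'⟩

theorem BoundaryPath.BeginsWith.comparable {a b : List E} {ξ : BoundaryPath Γ}
    (ha : ξ.BeginsWith a) (hb : ξ.BeginsWith b) : a <+: b ∨ b <+: a := by
  induction a generalizing b ξ with
  | nil => exact Or.inl List.nil_prefix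
  | cons f a ih =>
    cases b with
    | nil => exact Or.inr List.nil_prefix
    | cons f' b =>
      obtain ⟨ζ, μ, h₁, h₂⟩ := ha
      obtain ⟨ζ', μ', h₁', h₂'⟩ := hb
      obtain ⟨rfl, rfl⟩ := h₂.inj h₂'
      simpa using ih ⟨ζ, h₁⟩ ⟨ζ', h₁'⟩

/-- The action of a word in the letters `f`, `f⁻¹` on `X`, letter by letter, as a relation. -/
def ActRel : List (E × Bool) → BoundaryPath Γ → BoundaryPath Γ → Prop
  | [], ξ, η => η = ξ
  | (f, true) :: w, ξ, η => ∃ ζ, ActRel w ξ ζ ∧ IsCons f ζ η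
  | (f, false) :: w, ξ, η => ∃ ζ, ActRel w ξ ζ ∧ IsCons f η ζ

theorem actRel_append {w w' : List (E × Bool)} {ξ η : BoundaryPath Γ} :
    ActRel (w ++ w') ξ η ↔ ∃ ζ, ActRel w' ξ ζ ∧ ActRel w ζ η := by
  induction w generalizing η with
  | nil => simp [ActRel]
  | cons l w ih =>
    obtain ⟨f, _ | _⟩ := l <;>
    · simp only [List.cons_append, ActRel, ih]
      constructor
      · rintro ⟨μ, ⟨ν, h₁, h₂⟩, h₃⟩; exact ⟨ν, h₁, μ, h₂, h₃⟩
      · rintro ⟨ν, h₁, μ, h₂, h₃⟩; exact ⟨μ, ⟨ν, h₁, h₂⟩, h₃⟩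

theorem ActRel.unique {w : List (E × Bool)} {ξ η η' : BoundaryPath Γ} (h : ActRel w ξ η)
    (h' : ActRel w ξ η') : η = η' := by
  induction w generalizing η η' with
  | nil => exact Eq.trans h (Eq.symm h')
  | cons l w ih =>
    obtain ⟨f, _ | _⟩ := l
    · obtain ⟨ζ, h₁, h₂⟩ := h
      obtain ⟨ζ', h₁', h₂'⟩ := h'
      obtain rfl := ih h₁ h₁'
      exact (h₂.inj h₂').2
    · obtain ⟨ζ, h₁, h₂⟩ := h
      obtain ⟨ζ', h₁', h₂'⟩ := h'
      obtain rfl := ih h₁ h₁'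
      exact h₂.unique h₂'

theorem ActRel.red {w w' : List (E × Bool)} (hw : FreeGroup.Red w w') {ξ η : BoundaryPath Γ}
    (h : ActRel w ξ η) : ActRel w' ξ η := by
  induction hw with
  | refl => exact h
  | tail _ hs ih =>
    cases hs with
    | @not L₁ L₂ f b =>
      obtain ⟨ζ, h₁, h₂⟩ := actRel_append.1 ih
      refine actRel_append.2 ⟨ζ, ?_, h₂⟩
      cases b with
      | false =>
        obtain ⟨μ, ⟨ν, h₃, h₄⟩, h₅⟩ := h₁
        obtain rfl := (h₄.inj h₅).2
        exact h₃
      | true =>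
        obtain ⟨μ, ⟨ν, h₃, h₄⟩, h₅⟩ := h₁
        obtain rfl := h₄.unique h₅
        exact h₃

theorem ActRel.inv {w : List (E × Bool)} {ξ η : BoundaryPath Γ} (h : ActRel w ξ η) :
    ActRel (FreeGroup.invRev w) η ξ := by
  induction w generalizing η with
  | nil => exact Eq.symm h
  | cons l w ih =>
    rw [FreeGroup.invRev_cons]
    obtain ⟨f, _ | _⟩ := l <;>
    · obtain ⟨ζ, h₁, h₂⟩ := h
      exact actRel_append.2 ⟨ζ, ⟨_, rfl, h₂⟩, ih h₁⟩

theorem actRel_map_true {a : List E} {ζ η : BoundaryPath Γ} :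
    ActRel (a.map fun f => (f, true)) ζ η ↔ IsConcat a ζ η := by
  induction a generalizing η with
  | nil => exact Iff.rfl
  | cons f a ih => simp only [List.map_cons, ActRel, IsConcat, ih]

theorem actRel_pathWord {a b : List E} {ξ η : BoundaryPath Γ} :
    ActRel (pathWord a b) ξ η ↔ ∃ ζ, IsConcat b ζ ξ ∧ IsConcat a ζ η := by
  rw [pathWord, actRel_append]
  refine exists_congr fun ζ => ?_
  rw [actRel_map_true, ← actRel_map_true (a := b)]
  exact and_congr_left fun _ => ⟨fun h => by simpa using h.inv, fun h => h.inv⟩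

theorem pathWord_cons (f : E) (a b : List E) :
    pathWord (f :: a) b = (f, true) :: pathWord a b := rfl

theorem pathWord_nil_append_singleton (b : List E) (f : E) :
    pathWord [] (b ++ [f]) = (f, false) :: pathWord [] b := by
  simp [pathWord, FreeGroup.invRev]

theorem ActRel.exists_pathWord {w : List (E × Bool)} (hw : FreeGroup.IsReduced w)
    {ξ η : BoundaryPath Γ} (h : ActRel w ξ η) : ∃ a b : List E, w = pathWord a b := by
  induction w generalizing η with
  | nil => exact ⟨[], [], rfl⟩
  | cons l w ih =>
    have hw' : FreeGroup.IsReduced w := hw.infix ⟨[l], [], by simp⟩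
    obtain ⟨f, _ | _⟩ := l
    · obtain ⟨ζ, h₁, h₂⟩ := h
      obtain ⟨a, b, rfl⟩ := ih hw' h₁
      cases a with
      | nil => exact ⟨[], b ++ [f], (pathWord_nil_append_singleton b f).symm⟩
      | cons f' a =>
        exfalso
        obtain ⟨_, _, _, _, h₃⟩ := actRel_pathWord.1 h₁
        obtain ⟨rfl, -⟩ := h₂.inj h₃
        rw [pathWord_cons, FreeGroup.isReduced_cons_cons] at hw
        exact absurd (hw.1 rfl) (by simp)
    · obtain ⟨ζ, h₁, h₂⟩ := h
      obtain ⟨a, b, rfl⟩ := ih hw' h₁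
      exact ⟨f :: a, b, rfl⟩

theorem pathWord_inj {a b a' b' : List E} (h : pathWord a b = pathWord a' b') :
    a = a' ∧ b = b' := by
  induction a generalizing a' with
  | nil =>
    cases a' with
    | nil =>
      refine ⟨rfl, ?_⟩
      have := FreeGroup.invRev_injective (by simpa [pathWord] using h)
      exact List.map_injective_iff.2 (fun _ _ h => (Prod.ext_iff.1 h).1) this
    | cons f a' =>
      exfalso
      have : (f, true) ∈ pathWord [] b := h ▸ (by simp [pathWord])
      simp [pathWord, FreeGroup.invRev] at this
  | cons f a ih =>
    cases a' with
    | nil =>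
      exfalso
      have : (f, true) ∈ pathWord [] b' := h ▸ (by simp [pathWord])
      simp [pathWord, FreeGroup.invRev] at this
    | cons f' a' =>
      simp only [pathWord_cons, List.cons.injEq, Prod.mk.injEq] at h
      obtain ⟨h₁, h₂⟩ := ih h.2
      exact ⟨by rw [h.1.1, h₁], h₂⟩

open Classical in
theorem theta_iff_actRel {g : FreeGroup E} {ξ η : BoundaryPath Γ} :
    Γ.Theta g ξ η ↔ ActRel g.toWord ξ η := by
  constructor
  · rintro ⟨a, b, ζ, hr, rfl, hb, ha⟩
    rw [FreeGroup.toWord_mk, hr.reduce_eq]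
    exact actRel_pathWord.2 ⟨ζ, hb, ha⟩
  · intro h
    obtain ⟨a, b, hab⟩ := h.exists_pathWord FreeGroup.isReduced_toWord
    rw [hab] at h
    obtain ⟨ζ, hb, ha⟩ := actRel_pathWord.1 h
    exact ⟨a, b, ζ, hab ▸ FreeGroup.isReduced_toWord, by rw [← hab, FreeGroup.mk_toWord], hb, ha⟩

open Classical in
theorem Theta.unique {g : FreeGroup E} {ξ η η' : BoundaryPath Γ} (h : Γ.Theta g ξ η)
    (h' : Γ.Theta g ξ η') : η = η' :=
  (theta_iff_actRel.1 h).unique (theta_iff_actRel.1 h')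

open Classical in
theorem Theta.inv {g : FreeGroup E} {ξ η : BoundaryPath Γ} (h : Γ.Theta g ξ η) :
    Γ.Theta g⁻¹ η ξ := by
  rw [theta_iff_actRel, FreeGroup.toWord_inv]
  exact (theta_iff_actRel.1 h).inv

open Classical in
theorem Theta.trans {g h : FreeGroup E} {ξ η ζ : BoundaryPath Γ} (hh : Γ.Theta h ξ η)
    (hg : Γ.Theta g η ζ) : Γ.Theta (g * h) ξ ζ := by
  rw [theta_iff_actRel, FreeGroup.toWord_mul]
  exact ActRel.red FreeGroup.reduce.red
    (actRel_append.2 ⟨η, theta_iff_actRel.1 hh, theta_iff_actRel.1 hg⟩)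

open Classical in
theorem theta_one {ξ η : BoundaryPath Γ} : Γ.Theta 1 ξ η ↔ η = ξ := by
  rw [theta_iff_actRel, FreeGroup.toWord_one]
  exact Iff.rfl

theorem isReduced_map {a : List E} {b : Bool} :
    FreeGroup.IsReduced (a.map fun f => (f, b)) := by
  induction a with
  | nil => exact FreeGroup.IsReduced.nil
  | cons f a ih =>
    cases a with
    | nil => exact FreeGroup.IsReduced.singleton
    | cons f' a => exact FreeGroup.isReduced_cons_cons.2 ⟨fun _ => rfl, ih⟩

theorem isReduced_pathWord_nil_right (a : List E) : FreeGroup.IsReduced (pathWord a []) := by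
  simpa [pathWord] using isReduced_map (a := a) (b := true)

theorem isReduced_pathWord_nil_left (b : List E) : FreeGroup.IsReduced (pathWord [] b) := by
  have := isReduced_map (a := b.reverse) (b := false)
  simpa [pathWord, FreeGroup.invRev, Function.comp_def] using this

/-- `X_g` is the image of `θ_g`. -/
theorem mem_domain_iff {g : FreeGroup E} {η : BoundaryPath Γ} :
    η ∈ Γ.domain g ↔ ∃ ξ, Γ.Theta g ξ η := by
  constructor
  · rintro (rfl | ⟨x, b, y, -, hp, rfl, rfl⟩ | ⟨x, a, y, -, hp, rfl, ζ, hζ⟩ |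
      ⟨x, a, x', b, y, ha, -, hp, hp', hr, rfl, ζ, hζ⟩)
    · exact ⟨η, theta_one.2 rfl⟩
    · obtain ⟨ξ, hξ, -⟩ := exists_isConcat hp
      exact ⟨ξ, [], b, η, isReduced_pathWord_nil_left b, rfl, hξ, rfl⟩
    · exact ⟨ζ, a, [], ζ, isReduced_pathWord_nil_right a, rfl, rfl, hζ⟩
    · obtain rfl := (hp.eq_of_ne_nil ha hζ.isPath).2
      obtain ⟨ξ, hξ, -⟩ := exists_isConcat hp'
      exact ⟨ξ, a, b, ζ, hr, rfl, hξ, hζ⟩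
  · rintro ⟨ξ, a, b, ζ, hr, rfl, hb, ha⟩
    rcases eq_or_ne a [] with rfl | ha'
    · rcases eq_or_ne b [] with rfl | hb'
      · exact Or.inl rfl
      · obtain rfl : η = ζ := ha
        exact Or.inr (Or.inl ⟨_, b, _, hb', hb.isPath, rfl, rfl⟩)
    · rcases eq_or_ne b [] with rfl | hb'
      · exact Or.inr (Or.inr (Or.inl ⟨_, a, _, ha', ha.isPath, rfl, ζ, ha⟩))
      · exact Or.inr (Or.inr (Or.inr
          ⟨_, a, _, b, _, ha', hb', ha.isPath, hb.isPath, hr, rfl, ζ, ha⟩))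

theorem mem_domain_inv_iff {g : FreeGroup E} {ξ : BoundaryPath Γ} :
    ξ ∈ Γ.domain g⁻¹ ↔ ∃ η, Γ.Theta g ξ η := by
  rw [mem_domain_iff]
  exact ⟨fun ⟨η, h⟩ => ⟨η, by simpa using h.inv⟩, fun ⟨η, h⟩ => ⟨η, h.inv⟩⟩

theorem Theta.mem_domain_mul_iff {g h : FreeGroup E} {ξ η : BoundaryPath Γ} (hg : Γ.Theta g ξ η) :
    η ∈ Γ.domain (g * h) ↔ ξ ∈ Γ.domain h := by
  rw [mem_domain_iff, mem_domain_iff]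
  exact ⟨fun ⟨μ, hμ⟩ => ⟨μ, by simpa using hμ.trans hg.inv⟩, fun ⟨μ, hμ⟩ => ⟨μ, hμ.trans hg⟩⟩

/-- The paths in `X` that start at the vertex `x` and begin with `a`. -/
def cylinder (Γ : DirectedGraph V E) (x : V) (a : List E) : Set (BoundaryPath Γ) :=
  {ξ | ξ.source = x ∧ ξ.BeginsWith a}

open Classical in
theorem domain_eq_cylinder {g : FreeGroup E} (hg : g ≠ 1) :
    Γ.domain g = ∅ ∨ ∃ x a, Γ.domain g = Γ.cylinder x a := by
  rcases (Γ.domain g).eq_empty_or_nonempty with h | ⟨η₀, h⟩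
  · exact Or.inl h
  · right
    obtain ⟨ξ₀, a, b, ζ₀, hr, rfl, hb₀, ha₀⟩ := mem_domain_iff.1 h
    refine ⟨η₀.source, a, Set.ext fun η => ?_⟩
    rw [mem_domain_iff]
    constructor
    · rintro ⟨ξ, a', b', ζ, hr', he, hb, ha⟩
      have he' := congrArg FreeGroup.toWord he
      rw [FreeGroup.toWord_mk, FreeGroup.toWord_mk, hr.reduce_eq, hr'.reduce_eq] at he'
      obtain ⟨rfl, rfl⟩ := pathWord_inj he'
      refine ⟨?_, ζ, ha⟩
      rcases eq_or_ne a [] with rfl | hne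
      · rcases eq_or_ne b [] with rfl | hne
        · exact absurd rfl hg
        · obtain rfl : η = ζ := ha
          obtain rfl : η₀ = ζ₀ := ha₀
          exact (hb.isPath.eq_of_ne_nil hne hb₀.isPath).2
      · exact (ha.isPath.eq_of_ne_nil hne ha₀.isPath).1
    · rintro ⟨hs, ζ, ha⟩
      have hz : ζ.source = ζ₀.source := (hs ▸ ha.isPath).unique ha₀.isPath
      obtain ⟨ξ, hξ, -⟩ := exists_isConcat (ζ := ζ) (hz ▸ hb₀.isPath)
      exact ⟨ξ, a, b, ζ, hr, rfl, hξ, ha⟩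

theorem cylinder_inter (x y : V) (a b : List E) :
    Γ.cylinder x a ∩ Γ.cylinder y b = ∅ ∨ Γ.cylinder x a ∩ Γ.cylinder y b = Γ.cylinder x a ∨
      Γ.cylinder x a ∩ Γ.cylinder y b = Γ.cylinder y b := by
  rcases (Γ.cylinder x a ∩ Γ.cylinder y b).eq_empty_or_nonempty with h | ⟨ξ, ⟨rfl, ha⟩, ⟨rfl, hb⟩⟩
  · exact Or.inl h
  · right
    rcases ha.comparable hb with h | h
    · exact Or.inr (Set.inter_eq_right.2 fun η hη => ⟨hη.1, hη.2.prefix h⟩)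
    · exact Or.inl (Set.inter_eq_left.2 fun η hη => ⟨hη.1, hη.2.prefix h⟩)

end PathLemmas

/-! ### The algebra `D(X)` and the partial action of the free group on it -/

section DX

variable (K : Type w) [Field K] (Γ : DirectedGraph V E)

/-- The set `X_v` of the paths in `X` with source `v`. -/
def vertexSet (x : V) : Set (BoundaryPath Γ) := {ξ | ξ.source = x}

/-- The characteristic function of a subset of `X`, with values in `K`. -/
noncomputable def char (A : Set (BoundaryPath Γ)) : BoundaryPath Γ → K := A.indicator 1

/-- The functions `1_g`, for `g ≠ 1`, and `1_v`. -/
def spanningSet : Set (BoundaryPath Γ → K) :=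
  {f | ∃ g : FreeGroup E, g ≠ 1 ∧ f = char K Γ (Γ.domain g)} ∪
    {f | ∃ x : V, f = char K Γ (Γ.vertexSet x)}

variable {K Γ}

theorem char_of_mem {A : Set (BoundaryPath Γ)} {ξ : BoundaryPath Γ} (h : ξ ∈ A) :
    char K Γ A ξ = 1 := Set.indicator_of_mem h _

theorem char_of_notMem {A : Set (BoundaryPath Γ)} {ξ : BoundaryPath Γ} (h : ξ ∉ A) :
    char K Γ A ξ = 0 := Set.indicator_of_notMem h _

theorem char_mul_char (A B : Set (BoundaryPath Γ)) :
    char K Γ A * char K Γ B = char K Γ (A ∩ B) := by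
  funext ξ
  by_cases hA : ξ ∈ A <;> by_cases hB : ξ ∈ B <;>
    simp [char, hA, hB]

theorem char_empty : char K Γ ∅ = 0 := Set.indicator_empty _

theorem spanningSet_cylinder {f : BoundaryPath Γ → K} (hf : f ∈ spanningSet K Γ) :
    f = 0 ∨ ∃ x a, f = char K Γ (Γ.cylinder x a) := by
  rcases hf with ⟨g, hg, rfl⟩ | ⟨x, rfl⟩
  · rcases domain_eq_cylinder (Γ := Γ) hg with h | ⟨x, a, h⟩
    · exact Or.inl (by rw [h, char_empty])
    · exact Or.inr ⟨x, a, by rw [h]⟩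
  · refine Or.inr ⟨x, [], congrArg _ (Set.ext fun ξ => ?_)⟩
    exact ⟨fun h => ⟨h, ξ, rfl⟩, fun h => h.1⟩

theorem mul_mem_span {f f' : BoundaryPath Γ → K} (hf : f ∈ spanningSet K Γ)
    (hf' : f' ∈ spanningSet K Γ) : f * f' ∈ Submodule.span K (spanningSet K Γ) := by
  rcases spanningSet_cylinder hf with h | ⟨x, a, h⟩
  · rw [h, zero_mul]; exact zero_mem _
  rcases spanningSet_cylinder hf' with h' | ⟨x', a', h'⟩
  · rw [h', mul_zero]; exact zero_mem _
  have e : f * f' = char K Γ (Γ.cylinder x a ∩ Γ.cylinder x' a') := by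
    rw [h, h', char_mul_char]
  rcases cylinder_inter (Γ := Γ) x x' a a' with hc | hc | hc
  · rw [e, hc, char_empty]; exact zero_mem _
  · rw [e, hc, ← h]; exact Submodule.subset_span hf
  · rw [e, hc, ← h']; exact Submodule.subset_span hf'

variable (K Γ)

/-- The algebra `D(X)`: the linear span of the functions `1_g`, `g ≠ 1`, and `1_v`, inside the
algebra of all functions from `X` to `K`. -/
def DX : NonUnitalSubalgebra K (BoundaryPath Γ → K) :=
  { Submodule.span K (spanningSet K Γ) with
    mul_mem' := fun {a b} ha hb => by
      have h : Submodule.span K (spanningSet K Γ) * Submodule.span K (spanningSet K Γ) ≤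
          Submodule.span K (spanningSet K Γ) := by
        rw [Submodule.span_mul_span, Submodule.span_le]
        rintro _ ⟨f, hf, f', hf', rfl⟩
        exact mul_mem_span hf hf'
      exact h (Submodule.mul_mem_mul ha hb) }

theorem char_domain_mem {g : FreeGroup E} (hg : g ≠ 1) : char K Γ (Γ.domain g) ∈ DX K Γ :=
  Submodule.subset_span (Or.inl ⟨g, hg, rfl⟩)

theorem char_vertexSet_mem (x : V) : char K Γ (Γ.vertexSet x) ∈ DX K Γ :=
  Submodule.subset_span (Or.inr ⟨x, rfl⟩)

/-- The ideal `D_g = 1_g D(X)` of `D(X)`. (For `g = 1` this is `D(X)`.) -/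
noncomputable def idealD (g : FreeGroup E) : Submodule K (DX K Γ) where
  carrier := {f | ∃ h : DX K Γ, (f : BoundaryPath Γ → K) = char K Γ (Γ.domain g) * h}
  zero_mem' := ⟨0, by simp⟩
  add_mem' := by
    rintro _ _ ⟨h, hh⟩ ⟨h', hh'⟩
    exact ⟨h + h', by simp [hh, hh', mul_add]⟩
  smul_mem' := by
    rintro k _ ⟨h, hh⟩
    exact ⟨k • h, by simp [hh]⟩

open Classical in
/-- The map `α_g` on functions: `α_g(f) = f ∘ θ_{g⁻¹}` on `X_g`, and `0` elsewhere. -/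
noncomputable def transport (g : FreeGroup E) : (BoundaryPath Γ → K) →ₗ[K] (BoundaryPath Γ → K) where
  toFun f η := if h : ∃ ξ, Γ.Theta g⁻¹ η ξ then f h.choose else 0
  map_add' f f' := by
    funext η
    by_cases h : ∃ ξ, Γ.Theta g⁻¹ η ξ <;> simp [h]
  map_smul' k f := by
    funext η
    by_cases h : ∃ ξ, Γ.Theta g⁻¹ η ξ <;> simp [h]

variable {K Γ}

theorem transport_apply {g : FreeGroup E} {ξ η : BoundaryPath Γ} (h : Γ.Theta g ξ η)
    (f : BoundaryPath Γ → K) : transport K Γ g f η = f ξ := by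
  have h' : ∃ ξ, Γ.Theta g⁻¹ η ξ := ⟨ξ, h.inv⟩
  have : h'.choose = ξ := h'.choose_spec.unique h.inv
  exact (dif_pos h').trans (congrArg f this)

theorem transport_of_notMem {g : FreeGroup E} {η : BoundaryPath Γ} (h : η ∉ Γ.domain g)
    (f : BoundaryPath Γ → K) : transport K Γ g f η = 0 := by
  refine dif_neg fun ⟨ξ, hξ⟩ => h (mem_domain_iff.2 ⟨ξ, ?_⟩)
  simpa using hξ.inv

theorem mem_idealD_iff {g : FreeGroup E} {f : DX K Γ} :
    f ∈ idealD K Γ g ↔ ∀ η, η ∉ Γ.domain g → (f : BoundaryPath Γ → K) η = 0 := by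
  constructor
  · rintro ⟨h, hh⟩ η hη
    rw [hh, Pi.mul_apply, char_of_notMem hη, zero_mul]
  · intro h
    refine ⟨f, funext fun η => ?_⟩
    by_cases hη : η ∈ Γ.domain g
    · rw [Pi.mul_apply, char_of_mem hη, one_mul]
    · rw [Pi.mul_apply, char_of_notMem hη, zero_mul, h η hη]

theorem transport_char_domain (g h : FreeGroup E) :
    transport K Γ g (char K Γ (Γ.domain g⁻¹) * char K Γ (Γ.domain h)) =
      char K Γ (Γ.domain g) * char K Γ (Γ.domain (g * h)) := by
  funext η
  by_cases hη : η ∈ Γ.domain g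
  · obtain ⟨ξ, hξ⟩ := mem_domain_iff.1 hη
    rw [transport_apply hξ, Pi.mul_apply, Pi.mul_apply, char_of_mem hη,
      char_of_mem (mem_domain_inv_iff.2 ⟨η, hξ⟩)]
    by_cases hh : ξ ∈ Γ.domain h
    · rw [char_of_mem hh, char_of_mem (hξ.mem_domain_mul_iff.2 hh)]
    · rw [char_of_notMem hh, char_of_notMem (mt hξ.mem_domain_mul_iff.1 hh)]
  · rw [transport_of_notMem hη, Pi.mul_apply, char_of_notMem hη, zero_mul]

theorem transport_char_self (g : FreeGroup E) :
    transport K Γ g (char K Γ (Γ.domain g⁻¹)) = char K Γ (Γ.domain g) := by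
  funext η
  by_cases hη : η ∈ Γ.domain g
  · obtain ⟨ξ, hξ⟩ := mem_domain_iff.1 hη
    rw [transport_apply hξ, char_of_mem hη, char_of_mem (mem_domain_inv_iff.2 ⟨η, hξ⟩)]
  · rw [transport_of_notMem hη, char_of_notMem hη]

theorem transport_one (f : BoundaryPath Γ → K) : transport K Γ 1 f = f :=
  funext fun _ => transport_apply (theta_one.2 rfl) f

theorem char_domain_one_mul (f : BoundaryPath Γ → K) : char K Γ (Γ.domain 1) * f = f := by
  funext η
  rw [Pi.mul_apply, char_of_mem (Or.inl rfl), one_mul]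

theorem transport_mem_DX (g : FreeGroup E) (f : DX K Γ) :
    transport K Γ g (char K Γ (Γ.domain g⁻¹) * f) ∈ DX K Γ := by
  obtain ⟨f, hf⟩ := f
  rcases eq_or_ne g 1 with rfl | hg
  · rw [transport_one, inv_one, char_domain_one_mul]; exact hf
  have hle : Submodule.span K (spanningSet K Γ) ≤ (DX K Γ).toSubmodule.comap
      ((transport K Γ g).comp (LinearMap.mulLeft K (char K Γ (Γ.domain g⁻¹)))) := by
    rw [Submodule.span_le]
    rintro _ (⟨h, hh, rfl⟩ | ⟨x, rfl⟩)
    · show transport K Γ g (char K Γ (Γ.domain g⁻¹) * char K Γ (Γ.domain h)) ∈ DX K Γ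
      rw [transport_char_domain]
      rcases eq_or_ne (g * h) 1 with h1 | h1
      · rw [h1, mul_comm, char_domain_one_mul]; exact char_domain_mem K Γ hg
      · exact mul_mem (char_domain_mem K Γ hg) (char_domain_mem K Γ h1)
    · show transport K Γ g (char K Γ (Γ.domain g⁻¹) * char K Γ (Γ.vertexSet x)) ∈ DX K Γ
      rw [char_mul_char]
      have key : Γ.domain g⁻¹ ∩ Γ.vertexSet x = ∅ ∨
          Γ.domain g⁻¹ ∩ Γ.vertexSet x = Γ.domain g⁻¹ := by
        rcases domain_eq_cylinder (Γ := Γ) (inv_ne_one.2 hg) with h | ⟨y, a, h⟩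
        · exact Or.inl (by rw [h, Set.empty_inter])
        · rw [h]
          rcases eq_or_ne y x with rfl | hne
          · exact Or.inr (Set.inter_eq_left.2 fun η hη => hη.1)
          · exact Or.inl (Set.eq_empty_of_forall_notMem
              fun η hη => hne (hη.1.1.symm.trans hη.2))
      rcases key with h | h
      · rw [h, char_empty, map_zero]; exact zero_mem _
      · rw [h, transport_char_self]; exact char_domain_mem K Γ hg
  exact hle hf

theorem transport_mem {g : FreeGroup E} {f : DX K Γ} (hf : f ∈ idealD K Γ g⁻¹) :
    transport K Γ g f ∈ DX K Γ := by
  obtain ⟨h, hh⟩ := hf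
  rw [hh]
  exact transport_mem_DX g h

theorem transport_transport {g : FreeGroup E} {f : DX K Γ} (hf : f ∈ idealD K Γ g⁻¹) :
    transport K Γ g⁻¹ (transport K Γ g f) = f := by
  funext ξ
  by_cases hξ : ξ ∈ Γ.domain g⁻¹
  · obtain ⟨η, hη⟩ := mem_domain_inv_iff.1 hξ
    rw [transport_apply hη.inv, transport_apply hη]
  · rw [transport_of_notMem hξ, mem_idealD_iff.1 hf ξ hξ]

variable (K Γ)

/-- The map `α_g : D_{g⁻¹} → D_g`. -/
noncomputable def alphaMap (g : FreeGroup E) : idealD K Γ g⁻¹ →ₗ[K] idealD K Γ g where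
  toFun f := ⟨⟨transport K Γ g f.1, transport_mem f.2⟩,
    mem_idealD_iff.2 fun _ hη => transport_of_notMem hη _⟩
  map_add' _ _ := Subtype.ext (Subtype.ext (map_add (transport K Γ g) _ _))
  map_smul' _ _ := Subtype.ext (Subtype.ext (map_smul (transport K Γ g) _ _))

/-- The isomorphism `α_g : D_{g⁻¹} → D_g`, `f ↦ f ∘ θ_{g⁻¹}`. -/
noncomputable def alphaEquiv (g : FreeGroup E) : idealD K Γ g⁻¹ ≃ₗ[K] idealD K Γ g :=
  LinearEquiv.ofBijective (alphaMap K Γ g)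
    ⟨fun f f' h => by
      have h' : transport K Γ g f.1 = transport K Γ g f'.1 :=
        congrArg (fun z : idealD K Γ g => (z : DX K Γ).1) h
      exact Subtype.ext (Subtype.ext (by
        rw [← transport_transport f.2, ← transport_transport f'.2, h'])),
    fun f => by
      have hf : (f : DX K Γ) ∈ idealD K Γ (g⁻¹)⁻¹ := by rw [inv_inv]; exact f.2
      refine ⟨alphaMap K Γ g⁻¹ ⟨f, hf⟩, Subtype.ext (Subtype.ext ?_)⟩
      have := transport_transport hf
      rw [inv_inv] at this
      exact this⟩

/-- The partial action `(D_g, α_g)` of the free group on the edges on the algebra `D(X)`. -/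
noncomputable def freeGroupAction : PartialAction K (FreeGroup E) (DX K Γ) where
  D := idealD K Γ
  mul_mem_left g r x hx := mem_idealD_iff.2 fun η hη => by
    show (r : BoundaryPath Γ → K) η * (x : BoundaryPath Γ → K) η = 0
    rw [mem_idealD_iff.1 hx η hη, mul_zero]
  mul_mem_right g r x hx := mem_idealD_iff.2 fun η hη => by
    show (x : BoundaryPath Γ → K) η * (r : BoundaryPath Γ → K) η = 0
    rw [mem_idealD_iff.1 hx η hη, zero_mul]
  α := alphaEquiv K Γ
  map_mul g x y := Subtype.ext <| funext fun η => by
    show transport K Γ g (x.1.1 * y.1.1) η = transport K Γ g x.1.1 η * transport K Γ g y.1.1 η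
    by_cases hη : η ∈ Γ.domain g
    · obtain ⟨ξ, hξ⟩ := mem_domain_iff.1 hη
      simp only [transport_apply hξ, Pi.mul_apply]
    · simp only [transport_of_notMem hη, mul_zero]
  D_one := eq_top_iff.2 fun f _ => mem_idealD_iff.2 fun η hη => absurd (Or.inl rfl) hη
  α_one x := Subtype.ext (transport_one _)
  image_inter g h := by
    ext y
    constructor
    · rintro ⟨x, hx, rfl⟩
      refine ⟨(alphaEquiv K Γ g x).2, mem_idealD_iff.2 fun η hη => ?_⟩
      show transport K Γ g x.1.1 η = 0
      by_cases hη' : η ∈ Γ.domain g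
      · obtain ⟨ξ, hξ⟩ := mem_domain_iff.1 hη'
        rw [transport_apply hξ]
        exact mem_idealD_iff.1 hx ξ (mt hξ.mem_domain_mul_iff.2 hη)
      · exact transport_of_notMem hη' _
    · rintro ⟨hy, hy'⟩
      obtain ⟨x, hx⟩ := (alphaEquiv K Γ g).surjective ⟨y, hy⟩
      refine ⟨x, mem_idealD_iff.2 fun ξ hξ => ?_, congrArg Subtype.val hx⟩
      by_cases hξ' : ξ ∈ Γ.domain g⁻¹
      · obtain ⟨η, hη⟩ := mem_domain_inv_iff.1 hξ'
        have e : transport K Γ g x.1.1 η = y.1 η :=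
          congrArg (fun z : idealD K Γ g => z.1.1 η) hx
        rw [transport_apply hη] at e
        rw [e]
        exact mem_idealD_iff.1 hy' η (mt hη.mem_domain_mul_iff.1 hξ)
      · exact mem_idealD_iff.1 x.2 ξ hξ'
  comp g h r hr hr' hm := Subtype.ext <| funext fun η => by
    show transport K Γ g (transport K Γ h r.1) η = transport K Γ (g * h) r.1 η
    by_cases hη : η ∈ Γ.domain g
    · obtain ⟨ξ, hξ⟩ := mem_domain_iff.1 hη
      rw [transport_apply hξ]
      by_cases hξ' : ξ ∈ Γ.domain h
      · obtain ⟨μ, hμ⟩ := mem_domain_iff.1 hξ'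
        rw [transport_apply hμ, transport_apply (hμ.trans hξ)]
      · rw [transport_of_notMem hξ', transport_of_notMem (mt hξ.mem_domain_mul_iff.1 hξ')]
    · rw [transport_of_notMem hη]
      by_cases hη' : η ∈ Γ.domain (g * h)
      · obtain ⟨μ, hμ⟩ := mem_domain_iff.1 hη'
        rw [transport_apply hμ]
        refine (mem_idealD_iff.1 hr μ fun hμ' => hη ?_).symm
        obtain ⟨ξ, hξ⟩ := mem_domain_inv_iff.1 hμ'
        exact mem_domain_iff.2 ⟨ξ, by simpa using hξ.inv.trans hμ⟩
      · exact (transport_of_notMem hη' _).symm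

/-- The partial skew group ring `D(X) ⋆ 𝔽`. -/
abbrev SkewRing : Type _ := (freeGroupAction K Γ).SkewGroupRing

theorem char_domain_mem_idealD {g : FreeGroup E} (hg : g ≠ 1) :
    (⟨char K Γ (Γ.domain g), char_domain_mem K Γ hg⟩ : DX K Γ) ∈ (freeGroupAction K Γ).D g :=
  mem_idealD_iff.2 fun _ hη => char_of_notMem hη

theorem mem_D_one (f : DX K Γ) : f ∈ (freeGroupAction K Γ).D 1 :=
  mem_idealD_iff.2 fun _ hη => absurd (Or.inl rfl) hη

/-- The element `1_g δ_g`, for `g ≠ 1`. -/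
noncomputable def oneDelta (g : FreeGroup E) (hg : g ≠ 1) : SkewRing K Γ :=
  PartialAction.SkewGroupRing.single (freeGroupAction K Γ) g
    ⟨⟨char K Γ (Γ.domain g), char_domain_mem K Γ hg⟩, char_domain_mem_idealD K Γ hg⟩

/-- The element `1_v δ_1`, for a vertex `v`. -/
noncomputable def vertexDelta (x : V) : SkewRing K Γ :=
  PartialAction.SkewGroupRing.single (freeGroupAction K Γ) 1
    ⟨⟨char K Γ (Γ.vertexSet x), char_vertexSet_mem K Γ x⟩, mem_D_one K Γ _⟩

variable {K Γ}

/-- `φ` is the isomorphism of `K`-algebras from the Leavitt path algebra onto `D(X) ⋆ 𝔽` with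
`φ(f) = 1_f δ_f`, `φ(f*) = 1_{f⁻¹} δ_{f⁻¹}` and `φ(v) = 1_v δ_1`. -/
structure IsCanonicalIso (φ : LeavittPathAlgebra K Γ →ₙₐ[K] SkewRing K Γ) : Prop where
  bijective : Function.Bijective φ
  edge : ∀ f : E, φ (LeavittPathAlgebra.edge K Γ f) =
    oneDelta K Γ (FreeGroup.of f) (FreeGroup.of_ne_one f)
  ghost : ∀ f : E, φ (LeavittPathAlgebra.ghost K Γ f) =
    oneDelta K Γ (FreeGroup.of f)⁻¹ (inv_ne_one.2 (FreeGroup.of_ne_one f))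
  vertex : ∀ x : V, φ (LeavittPathAlgebra.vertex K Γ x) = vertexDelta K Γ x

/-- The family of subgroups `φ⁻¹(D_g δ_g)`, indexed by the free group on the edges. -/
noncomputable def inducedGrading (φ : LeavittPathAlgebra K Γ →ₙₐ[K] SkewRing K Γ)
    (g : FreeGroup E) : AddSubgroup (LeavittPathAlgebra K Γ) :=
  ((PartialAction.SkewGroupRing.component (freeGroupAction K Γ) g).comap
    (φ : LeavittPathAlgebra K Γ →ₗ[K] SkewRing K Γ)).toAddSubgroup

end DX

end DirectedGraph

/-! ### Coefficients in a partial skew group ring -/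

namespace PartialAction.SkewGroupRing

variable {K : Type*} {G : Type*} {R : Type*} [CommRing K] [Group G] [NonUnitalRing R] [Module K R]
  [IsScalarTower K R R] [SMulCommClass K R R] (P : PartialAction K G R)

/-! The algebra `D(X)` consists of functions on `X`, so an identity between homogeneous elements of
`D(X) ⋆ 𝔽` can be checked at each boundary path (`coeffMul_apply`). Associativity and the Leavitt
relations are checked in this way, which gives the homomorphism `toSkewRing`. The sum relation at a
vertex says that a path starting at a vertex that emits edges has exactly one first edge
(`vertexDelta_eq_sum`).

Surjectivity: if `w` is a reduced word, `1_w δ_w` is the product of the elements belonging to its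
letters, because `X_{ww'} ⊆ X_w` when `ww'` is reduced. The functions `1_g` then arise from `(1_g
δ_g)(1_{g⁻¹} δ_{g⁻¹}) = 1_g δ_1`, and everything else from `r δ_g = (r δ_1)(1_g δ_g)`.

Injectivity: the monomials `a x b*` span, and their images have degree `a b⁻¹`, so one degree can be
treated at a time. Cancelling common suffixes puts a whole degree in the form `a y b*` with `a`, `b`
fixed and `y` in the span of the `d x d*`. Multiplying by ghosts on the left and edges on the right
strips off `a` and `b`. On the diagonal (`eq_zero_of_mem_diagonal`), a kernel element `∑ c_x x + ∑ f
t_f f*` is compressed to `f* y f`, which vanishes by induction on the path length. This forces `y =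
∑ c_x x - ∑ c_{s(f)} f f*`, where every edge leaving the support of `c` occurs, and the sum
relations make this zero.

Equivalence: `1_g δ_1` is a left identity for degree `g`. Hence `X_g = X` whenever all vertices lie
in `L_g L_{g⁻¹}`, or there is a unit of degree `g`. Strong grading gives this for every `g`; the
clean and unit-regular conditions, applied to an edge `f`, yield a homogeneous unit of degree `f` or
`f⁻¹`. If `X_f = X_{f⁻¹} = X`, every path begins with `f` and starts at `r(f)`, so the graph is a
single loop (`isLoop_of_domain_eq_univ`). Conversely, for a single loop `X` is a point and `D(X) ⋆
𝔽` is the group algebra of `𝔽 ≅ ℤ`, in which nonzero homogeneous elements are invertible. -/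

/-- The coefficient of `δ_g`. -/
noncomputable def coeff (g : G) : P.SkewGroupRing →ₗ[K] P.D g :=
  DirectSum.component K G (fun g => P.D g) g

theorem coeff_single_self (g : G) (r : P.D g) : coeff P g (single P g r) = r := by
  classical
  exact DirectSum.component.lof_self (R := K) (M := fun g => P.D g) g r

theorem coeff_single_of_ne {g h : G} (hgh : g ≠ h) (r : P.D g) :
    coeff P h (single P g r) = 0 := by
  classical
  exact (DirectSum.component.of (R := K) (M := fun g => P.D g) h g r).trans (dif_neg hgh)

theorem single_injective (g : G) : Function.Injective (single P g) :=
  Function.LeftInverse.injective (g := coeff P g) (coeff_single_self P g)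

variable {P} in
theorem induction_on {p : P.SkewGroupRing → Prop} (z : P.SkewGroupRing) (h0 : p 0)
    (hadd : ∀ a b, p a → p b → p (a + b)) (hsingle : ∀ g r, p (single P g r)) : p z := by
  classical
  exact DirectSum.induction_on (motive := p) z h0 hsingle hadd

end PartialAction.SkewGroupRing

namespace DirectedGraph

variable {V : Type u} {E : Type v}

/-! ### Boundary paths -/

section BoundaryPaths

variable {Γ : DirectedGraph V E}

open BoundaryPath

theorem BoundaryPath.IsCons.source_eq {f : E} {ξ η : BoundaryPath Γ} (h : IsCons f ξ η) :
    η.source = Γ.s f := by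
  obtain ⟨h, rfl⟩ := h
  exact source_cons f ξ h

theorem BoundaryPath.exists_isCons {f : E} {ξ : BoundaryPath Γ} (h : ξ.source = Γ.r f) :
    ∃ η, IsCons f ξ η := ⟨_, h.symm, rfl⟩

/-- The only boundary paths without a first edge are those of length zero, and these are sinks by
the definition of `X`. This is the exhaustion half of the sum relation; `IsCons.inj` is the
disjointness half. -/
theorem BoundaryPath.isSink_or_exists_isCons (η : BoundaryPath Γ) :
    Γ.IsSink η.source ∨ ∃ f ξ, IsCons f ξ η := by
  cases η with
  | finite x a h =>
    obtain ⟨y, hy, hp⟩ := h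
    cases a with
    | nil =>
      obtain rfl : x = y := hp
      exact Or.inl hy
    | cons f a =>
      obtain ⟨rfl, hp⟩ := hp
      exact Or.inr ⟨f, finite (Γ.r f) a ⟨y, hy, hp⟩, rfl, rfl⟩
  | infinite p h =>
    refine Or.inr ⟨p 0, infinite (fun n => p (n + 1)) fun i => h (i + 1), h 0, ?_⟩
    simp only [cons, infinite.injEq]
    funext n
    cases n <;> rfl

/-- Every vertex is the source of a path in `X`. -/
theorem BoundaryPath.exists_source_eq (Γ : DirectedGraph V E) (x : V) :
    ∃ ξ : BoundaryPath Γ, ξ.source = x := by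
  classical
  by_cases hx : Γ.IsSink x
  · exact ⟨finite x [] ⟨x, hx, rfl⟩, rfl⟩
  -- The choice of an outgoing edge must be total on `V`. At sinks it returns an arbitrary edge,
  -- which exists because `x` is not a sink.
  have hex : ∀ y : V, ∃ f : E, ¬ Γ.IsSink y → Γ.s f = y := fun y => by
    by_cases hy : Γ.IsSink y
    · simp only [IsSink, not_forall] at hx
      exact ⟨hx.choose, fun h => absurd hy h⟩
    · have hy' := hy
      simp only [IsSink, not_forall, not_not] at hy'
      exact ⟨hy'.choose, fun _ => hy'.choose_spec⟩
  choose next hnext using hex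
  have hfin : ∀ (n : ℕ) (y : V), Γ.IsSink ((fun z => Γ.r (next z))^[n] y) →
      ∃ ξ : BoundaryPath Γ, ξ.source = y := by
    intro n
    induction n with
    | zero => intro y hy; exact ⟨finite y [] ⟨y, hy, rfl⟩, rfl⟩
    | succ n ih =>
      intro y hy
      by_cases hs : Γ.IsSink y
      · exact ⟨finite y [] ⟨y, hs, rfl⟩, rfl⟩
      · obtain ⟨ξ, hξ⟩ := ih _ hy
        exact ⟨cons (next y) ξ hξ.symm, (source_cons _ _ _).trans (hnext y hs)⟩
  -- Follow the chosen edges from `x`. If the walk meets a sink it gives a finite path, otherwise an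
  -- infinite one.
  by_cases h : ∃ n, Γ.IsSink ((fun z => Γ.r (next z))^[n] x)
  · obtain ⟨n, hn⟩ := h
    exact hfin n x hn
  · rw [not_exists] at h
    refine ⟨infinite (fun n => next ((fun z => Γ.r (next z))^[n] x)) fun i => ?_, hnext x hx⟩
    rw [hnext _ (h (i + 1)), Function.iterate_succ_apply']

open Classical in
theorem theta_of {f : E} {ξ η : BoundaryPath Γ} :
    Γ.Theta (FreeGroup.of f) ξ η ↔ IsCons f ξ η := by
  rw [theta_iff_actRel, FreeGroup.toWord_of]
  simp [ActRel]

theorem theta_of_inv {f : E} {ξ η : BoundaryPath Γ} :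
    Γ.Theta (FreeGroup.of f)⁻¹ η ξ ↔ IsCons f ξ η := by
  rw [← theta_of]
  exact ⟨fun h => by simpa using h.inv, fun h => h.inv⟩

theorem mem_domain_of {f : E} {η : BoundaryPath Γ} :
    η ∈ Γ.domain (FreeGroup.of f) ↔ ∃ ξ, IsCons f ξ η := by
  simp only [mem_domain_iff, theta_of]

theorem mem_domain_of_inv {f : E} {ξ : BoundaryPath Γ} :
    ξ ∈ Γ.domain (FreeGroup.of f)⁻¹ ↔ ξ.source = Γ.r f := by
  simp only [mem_domain_inv_iff, theta_of]
  exact ⟨fun ⟨_, h, _⟩ => h.symm, exists_isCons⟩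

end BoundaryPaths

/-! ### The product of the partial skew group ring -/

section SkewRing

open PartialAction.SkewGroupRing

variable {K : Type w} [Field K] {Γ : DirectedGraph V E}

/-- The map `α_g` is multiplicative and undoes `α_{g⁻¹}` on `D_g`. Since `transport` extends by zero
off `X_g`, the right side makes sense for every `r'`, not only for `r'` in `D_{g⁻¹}`, and products
become pointwise expressions. -/
theorem coeffMul_apply {g h : FreeGroup E} (r : (freeGroupAction K Γ).D g)
    (r' : (freeGroupAction K Γ).D h) :
    ((freeGroupAction K Γ).coeffMul g h r r' : BoundaryPath Γ → K) =
      r.1.1 * transport K Γ g r'.1.1 := by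
  show transport K Γ g (transport K Γ g⁻¹ r.1.1 * r'.1.1) = _
  funext η
  by_cases hη : η ∈ Γ.domain g
  · obtain ⟨ξ, hξ⟩ := mem_domain_iff.1 hη
    rw [transport_apply hξ, Pi.mul_apply, Pi.mul_apply, transport_apply hξ,
      transport_apply hξ.inv]
  · rw [transport_of_notMem hη, Pi.mul_apply, mem_idealD_iff.1 r.2 η hη, zero_mul]

/-- Coefficients of equal but not syntactically identical degrees have different types; this allows
them to be compared as plain functions on `X`. -/
theorem single_congr {g h : FreeGroup E} (hgh : g = h) {r : (freeGroupAction K Γ).D g}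
    {r' : (freeGroupAction K Γ).D h} (hr : r.1.1 = r'.1.1) :
    single (freeGroupAction K Γ) g r = single (freeGroupAction K Γ) h r' := by
  subst hgh
  exact congrArg _ (Subtype.ext (Subtype.ext hr))

/-- To compute a product of two homogeneous elements it is enough to know the function
`r (r' ∘ θ_{g⁻¹})`. -/
theorem single_mul_single_eq {g h k : FreeGroup E} {r : (freeGroupAction K Γ).D g}
    {r' : (freeGroupAction K Γ).D h} {t : (freeGroupAction K Γ).D k} (hk : g * h = k)
    (ht : r.1.1 * transport K Γ g r'.1.1 = t.1.1) :
    single (freeGroupAction K Γ) g r * single (freeGroupAction K Γ) h r' =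
      single (freeGroupAction K Γ) k t := by
  rw [single_mul_single]
  exact single_congr hk ((coeffMul_apply r r').trans ht)

theorem transport_char_mul (g : FreeGroup E) (a : BoundaryPath Γ → K) :
    char K Γ (Γ.domain g) * transport K Γ g a = transport K Γ g a := by
  funext η
  by_cases hη : η ∈ Γ.domain g
  · rw [Pi.mul_apply, char_of_mem hη, one_mul]
  · rw [Pi.mul_apply, transport_of_notMem hη, mul_zero]

/-- The composition law `α_g α_h = α_{gh}` on functions supported in `X_{h⁻¹}`, restricted to a
function supported in `X_h`. -/
theorem transport_mul_transport (g h : FreeGroup E) {a : BoundaryPath Γ → K}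
    (ha : ∀ η, η ∉ Γ.domain g → a η = 0) {b : BoundaryPath Γ → K}
    (hb : ∀ η, η ∉ Γ.domain h → b η = 0) (c : BoundaryPath Γ → K) :
    a * transport K Γ g b * transport K Γ (g * h) c =
      a * transport K Γ g (b * transport K Γ h c) := by
  funext η
  by_cases hη : η ∈ Γ.domain g
  · obtain ⟨ξ, hξ⟩ := mem_domain_iff.1 hη
    simp only [Pi.mul_apply, transport_apply hξ]
    by_cases hξ' : ξ ∈ Γ.domain h
    · obtain ⟨μ, hμ⟩ := mem_domain_iff.1 hξ'
      rw [transport_apply hμ, transport_apply (hμ.trans hξ), mul_assoc]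
    · rw [hb ξ hξ', zero_mul, mul_zero, zero_mul]
  -- A path outside `X_g` may still lie in `X_{gh}` because of cancellation in `gh`. The left side
  -- vanishes there thanks to the support of `a`.
  · simp only [Pi.mul_apply, ha η hη, zero_mul]

/-- Partial skew group rings are not associative in general. Here trilinearity reduces the claim to
homogeneous elements, where it is the pointwise identity `transport_mul_transport`. -/
theorem SkewRing.mul_assoc (a b c : SkewRing K Γ) : a * b * c = a * (b * c) := by
  induction a using PartialAction.SkewGroupRing.induction_on with
  | h0 => simp
  | hadd a a' h h' => simp only [add_mul, h, h']
  | hsingle g r =>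
    induction b using PartialAction.SkewGroupRing.induction_on with
    | h0 => simp
    | hadd b b' h h' => simp only [add_mul, mul_add, h, h']
    | hsingle h r' =>
      induction c using PartialAction.SkewGroupRing.induction_on with
      | h0 => simp
      | hadd c c' h h' => simp only [mul_add, h, h']
      | hsingle k r'' =>
        simp only [single_mul_single]
        refine single_congr (_root_.mul_assoc g h k) ?_
        rw [coeffMul_apply, coeffMul_apply]
        simp only [coeffMul_apply]
        exact transport_mul_transport g h (mem_idealD_iff.1 r.2) (mem_idealD_iff.1 r'.2) _

noncomputable instance : NonUnitalRing (SkewRing K Γ) where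
  mul_assoc := SkewRing.mul_assoc

instance : IsScalarTower K (SkewRing K Γ) (SkewRing K Γ) where
  smul_assoc k a b := by
    simp only [smul_eq_mul, mul_def, map_smul, LinearMap.smul_apply]

instance : SMulCommClass K (SkewRing K Γ) (SkewRing K Γ) where
  smul_comm k a b := by
    simp only [smul_eq_mul, mul_def, map_smul]

/-! ### The defining relations in the partial skew group ring -/

theorem vertexDelta_mul_self (x : V) :
    vertexDelta K Γ x * vertexDelta K Γ x = vertexDelta K Γ x :=
  single_mul_single_eq (mul_one 1) (by
    simp only [transport_one, char_mul_char, Set.inter_self])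

theorem vertexDelta_mul_of_ne {x y : V} (h : x ≠ y) :
    vertexDelta K Γ x * vertexDelta K Γ y = 0 := by
  refine (single_mul_single_eq (t := 0) (mul_one 1) ?_).trans (map_zero _)
  have : Γ.vertexSet x ∩ Γ.vertexSet y = ∅ :=
    Set.eq_empty_of_forall_notMem fun ξ hξ => h (hξ.1.symm.trans hξ.2)
  simp only [transport_one, char_mul_char, this, char_empty]
  rfl

theorem vertexDelta_mul_oneDelta {x : V} {g : FreeGroup E} (hg : g ≠ 1)
    (h : Γ.domain g ⊆ Γ.vertexSet x) :
    vertexDelta K Γ x * oneDelta K Γ g hg = oneDelta K Γ g hg :=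
  single_mul_single_eq (one_mul g) (by
    simp only [transport_one, char_mul_char, Set.inter_eq_right.2 h])

/-- The bijection `θ_{g⁻¹}` sends `X_g` onto `X_{g⁻¹}`, so a function equal to `1` on `X_{g⁻¹}`
pulls back to `1` on `X_g`. Both the relations `f r(f) = f` and the products `(1_g δ_g)(1_{g⁻¹}
δ_{g⁻¹})` are instances. -/
theorem char_mul_transport_char {g : FreeGroup E} {A : Set (BoundaryPath Γ)}
    (h : Γ.domain g⁻¹ ⊆ A) :
    char K Γ (Γ.domain g) * transport K Γ g (char K Γ A) = char K Γ (Γ.domain g) := by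
  rw [transport_char_mul]
  funext η
  by_cases hη : η ∈ Γ.domain g
  · obtain ⟨ξ, hξ⟩ := mem_domain_iff.1 hη
    rw [transport_apply hξ, char_of_mem hη, char_of_mem (h (mem_domain_inv_iff.2 ⟨η, hξ⟩))]
  · rw [transport_of_notMem hη, char_of_notMem hη]

theorem oneDelta_mul_vertexDelta {x : V} {g : FreeGroup E} (hg : g ≠ 1)
    (h : Γ.domain g⁻¹ ⊆ Γ.vertexSet x) :
    oneDelta K Γ g hg * vertexDelta K Γ x = oneDelta K Γ g hg :=
  single_mul_single_eq (mul_one g) (char_mul_transport_char h)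

variable (K Γ) in
/-- The element `1_g δ_1`, for `g ≠ 1`. -/
noncomputable def domainDelta (g : FreeGroup E) (hg : g ≠ 1) : SkewRing K Γ :=
  single (freeGroupAction K Γ) 1
    ⟨⟨char K Γ (Γ.domain g), char_domain_mem K Γ hg⟩, mem_D_one K Γ _⟩

theorem oneDelta_mul_oneDelta_inv {g : FreeGroup E} (hg : g ≠ 1) :
    oneDelta K Γ g hg * oneDelta K Γ g⁻¹ (inv_ne_one.2 hg) = domainDelta K Γ g hg :=
  single_mul_single_eq (mul_inv_cancel g) (char_mul_transport_char subset_rfl)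

theorem oneDelta_inv_mul_oneDelta {g : FreeGroup E} (hg : g ≠ 1) :
    oneDelta K Γ g⁻¹ (inv_ne_one.2 hg) * oneDelta K Γ g hg =
      domainDelta K Γ g⁻¹ (inv_ne_one.2 hg) :=
  single_mul_single_eq (inv_mul_cancel g) (char_mul_transport_char (by rw [inv_inv]))

theorem domain_of_inv (f : E) : Γ.domain (FreeGroup.of f)⁻¹ = Γ.vertexSet (Γ.r f) :=
  Set.ext fun _ => mem_domain_of_inv

theorem domain_of_subset (f : E) : Γ.domain (FreeGroup.of f) ⊆ Γ.vertexSet (Γ.s f) := by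
  intro η hη
  obtain ⟨ξ, hξ⟩ := mem_domain_of.1 hη
  exact hξ.source_eq

theorem domainDelta_of_inv (f : E) :
    domainDelta K Γ (FreeGroup.of f)⁻¹ (inv_ne_one.2 (FreeGroup.of_ne_one f)) =
      vertexDelta K Γ (Γ.r f) :=
  single_congr rfl (congrArg (char K Γ) (domain_of_inv f))

/-- First edges are unique, so no path `f ξ` lies in `X_{f'}`. -/
theorem oneDelta_inv_mul_of_ne {f f' : E} (h : f ≠ f') :
    oneDelta K Γ (FreeGroup.of f)⁻¹ (inv_ne_one.2 (FreeGroup.of_ne_one f)) *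
      oneDelta K Γ (FreeGroup.of f') (FreeGroup.of_ne_one f') = 0 := by
  refine (single_mul_single_eq (t := 0) rfl ?_).trans (map_zero _)
  show char K Γ _ * transport K Γ _ (char K Γ _) = 0
  rw [transport_char_mul]
  funext ξ
  by_cases hξ : ξ ∈ Γ.domain (FreeGroup.of f)⁻¹
  · obtain ⟨η, hη⟩ := mem_domain_iff.1 hξ
    rw [transport_apply hη, char_of_notMem, Pi.zero_apply]
    intro hη'
    obtain ⟨ξ', hξ'⟩ := mem_domain_of.1 hη'
    exact h ((theta_of_inv.1 hη).inj hξ').1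
  · rw [transport_of_notMem hξ, Pi.zero_apply]

/-- The set `X_x` is the disjoint union of the `X_f` with `s(f) = x`. Nonemptiness of `F` excludes a
sink `x`, for which `X_x` contains the path of length zero. -/
theorem vertexDelta_eq_sum {x : V} {F : Finset E} (hne : F.Nonempty)
    (hF : ∀ f : E, f ∈ F ↔ Γ.s f = x) :
    vertexDelta K Γ x =
      ∑ f ∈ F, domainDelta K Γ (FreeGroup.of f) (FreeGroup.of_ne_one f) := by
  unfold domainDelta vertexDelta
  rw [← map_sum]
  refine congrArg _ (Subtype.ext (Subtype.ext ?_))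
  have hval : ((∑ f ∈ F, (⟨⟨char K Γ (Γ.domain (FreeGroup.of f)), char_domain_mem K Γ
      (FreeGroup.of_ne_one f)⟩, mem_D_one K Γ _⟩ : (freeGroupAction K Γ).D 1)).1.1) =
      ∑ f ∈ F, char K Γ (Γ.domain (FreeGroup.of f)) := by
    rw [AddSubmonoidClass.coe_finsetSum]
    exact map_sum (NonUnitalSubalgebraClass.subtype (DX K Γ)) _ _
  refine Eq.trans ?_ hval.symm
  funext ξ
  rw [Finset.sum_apply]
  by_cases hξ : ξ.source = x
  · rcases ξ.isSink_or_exists_isCons with hs | ⟨f, ζ, hf⟩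
    · obtain ⟨f, hf⟩ := hne
      exact absurd (((hF f).1 hf).trans hξ.symm) (hs f)
    · rw [Finset.sum_eq_single f, char_of_mem (mem_domain_of.2 ⟨ζ, hf⟩)]
      · exact char_of_mem hξ
      · intro f' _ hne'
        refine char_of_notMem fun h => hne' ?_
        obtain ⟨ζ', hζ'⟩ := mem_domain_of.1 h
        exact (hζ'.inj hf).1
      · exact fun hn => absurd ((hF f).2 (hf.source_eq.symm.trans hξ)) hn
  · rw [Finset.sum_eq_zero]
    · exact char_of_notMem hξ
    · intro f hf
      exact char_of_notMem fun h => hξ ((domain_of_subset f h).trans ((hF f).1 hf))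

/-- The set `X_x` is never empty. As the Leavitt path algebra is only given by a presentation,
nonvanishing of its vertices and edges is deduced from this. -/
theorem vertexDelta_ne_zero (x : V) : vertexDelta K Γ x ≠ 0 := by
  intro h
  obtain ⟨ξ, hξ⟩ := BoundaryPath.exists_source_eq Γ x
  have h0 := single_injective _ 1 (h.trans (map_zero (single _ 1)).symm)
  have h1 : char K Γ (Γ.vertexSet x) = 0 := congrArg (fun z => z.1.1) h0
  have h2 := congrFun h1 ξ
  rw [char_of_mem hξ] at h2
  exact one_ne_zero h2

/-! ### The homomorphism from the Leavitt path algebra -/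

variable (K Γ) in
/-- The images of the generators. -/
noncomputable def genImage : Gen V E → SkewRing K Γ
  | .vertex x => vertexDelta K Γ x
  | .edge f => oneDelta K Γ (FreeGroup.of f) (FreeGroup.of_ne_one f)
  | .ghost f => oneDelta K Γ (FreeGroup.of f)⁻¹ (inv_ne_one.2 (FreeGroup.of_ne_one f))

variable (K Γ) in
/-- The homomorphism from the free algebra that sends the generators to their images. -/
noncomputable def freeHom : FreeAlg K V E →ₙₐ[K] SkewRing K Γ :=
  MonoidAlgebra.liftMagma K (FreeSemigroup.lift (genImage K Γ))

theorem freeHom_gen (x : Gen V E) : freeHom K Γ (gen K x) = genImage K Γ x := by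
  simp [freeHom, gen, MonoidAlgebra.liftMagma]

theorem freeHom_rel {a b : FreeAlg K V E} (h : LeavittRel K Γ a b) :
    freeHom K Γ a = freeHom K Γ b := by
  cases h <;> simp only [map_mul, map_zero, map_sum, freeHom_gen, genImage]
  case vertex_idem x => exact vertexDelta_mul_self x
  case vertex_orth x y h => exact vertexDelta_mul_of_ne h
  case source_edge f => exact vertexDelta_mul_oneDelta _ (domain_of_subset f)
  case edge_range f => exact oneDelta_mul_vertexDelta _ (domain_of_inv f).subset
  case range_ghost f => exact vertexDelta_mul_oneDelta _ (domain_of_inv f).subset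
  case ghost_source f =>
    exact oneDelta_mul_vertexDelta _ (by rw [inv_inv]; exact domain_of_subset f)
  case ghost_edge f => rw [oneDelta_inv_mul_oneDelta, domainDelta_of_inv]
  case ghost_edge_ne f f' h => exact oneDelta_inv_mul_of_ne h
  case sum_edges x F hne hF =>
    simp only [oneDelta_mul_oneDelta_inv]
    exact vertexDelta_eq_sum hne hF

theorem freeHom_con {a b : FreeAlg K V E} (h : leavittCon K Γ a b) :
    freeHom K Γ a = freeHom K Γ b := by
  have h' : RingConGen.Rel (LeavittRelSMul K Γ) a b := h
  clear h
  induction h' with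
  | of x y hxy =>
    obtain ⟨l, a', b', hab, rfl, rfl⟩ := hxy
    rw [map_smul, map_smul, freeHom_rel hab]
  | refl x => rfl
  | symm h ih => exact ih.symm
  | trans h₁ h₂ ih₁ ih₂ => exact ih₁.trans ih₂
  | add h₁ h₂ ih₁ ih₂ => rw [map_add, map_add, ih₁, ih₂]
  | mul h₁ h₂ ih₁ ih₂ => rw [map_mul, map_mul, ih₁, ih₂]

variable (K Γ) in
/-- The homomorphism from the Leavitt path algebra to the partial skew group ring. -/
noncomputable def toSkewRing : LeavittPathAlgebra K Γ →ₙₐ[K] SkewRing K Γ where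
  toFun := Quotient.lift (freeHom K Γ) fun _ _ h => freeHom_con h
  map_smul' k a := by
    obtain ⟨a, rfl⟩ := LeavittPathAlgebra.mk_surjective K Γ a
    exact map_smul (freeHom K Γ) k a
  map_zero' := map_zero (freeHom K Γ)
  map_add' a b := by
    obtain ⟨a, rfl⟩ := LeavittPathAlgebra.mk_surjective K Γ a
    obtain ⟨b, rfl⟩ := LeavittPathAlgebra.mk_surjective K Γ b
    exact map_add (freeHom K Γ) a b
  map_mul' a b := by
    obtain ⟨a, rfl⟩ := LeavittPathAlgebra.mk_surjective K Γ a
    obtain ⟨b, rfl⟩ := LeavittPathAlgebra.mk_surjective K Γ b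
    exact map_mul (freeHom K Γ) a b

theorem toSkewRing_vertex (x : V) :
    toSkewRing K Γ (LeavittPathAlgebra.vertex K Γ x) = vertexDelta K Γ x := freeHom_gen _

theorem toSkewRing_edge (f : E) : toSkewRing K Γ (LeavittPathAlgebra.edge K Γ f) =
    oneDelta K Γ (FreeGroup.of f) (FreeGroup.of_ne_one f) := freeHom_gen _

theorem toSkewRing_ghost (f : E) : toSkewRing K Γ (LeavittPathAlgebra.ghost K Γ f) =
    oneDelta K Γ (FreeGroup.of f)⁻¹ (inv_ne_one.2 (FreeGroup.of_ne_one f)) := freeHom_gen _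

/-- A homomorphism on the Leavitt path algebra is determined by its values on the generators. -/
theorem LeavittPathAlgebra.hom_ext {φ ψ : LeavittPathAlgebra K Γ →ₙₐ[K] SkewRing K Γ}
    (hv : ∀ x, φ (vertex K Γ x) = ψ (vertex K Γ x)) (he : ∀ f, φ (edge K Γ f) = ψ (edge K Γ f))
    (hg : ∀ f, φ (ghost K Γ f) = ψ (ghost K Γ f)) : φ = ψ := by
  let π : FreeAlg K V E →ₙₐ[K] LeavittPathAlgebra K Γ :=
    { toFun := mk K Γ, map_smul' := fun _ _ => rfl, map_zero' := rfl,
      map_add' := fun _ _ => rfl, map_mul' := fun _ _ => rfl }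
  have h : φ.comp π = ψ.comp π := by
    refine MonoidAlgebra.nonUnitalAlgHom_ext' K (FreeSemigroup.hom_ext (funext fun x => ?_))
    cases x
    · exact hv _
    · exact he _
    · exact hg _
  refine NonUnitalAlgHom.ext fun a => ?_
  obtain ⟨a, rfl⟩ := mk_surjective K Γ a
  exact DFunLike.congr_fun h a

end SkewRing

end DirectedGraph

namespace DirectedGraph

variable {V : Type u} {E : Type v}

/-! ### Monomials in the Leavitt path algebra -/

namespace LeavittPathAlgebra

variable {K : Type w} [Field K] {Γ : DirectedGraph V E}

instance : IsScalarTower K (LeavittPathAlgebra K Γ) (LeavittPathAlgebra K Γ) where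
  smul_assoc k a b := by
    obtain ⟨a, rfl⟩ := mk_surjective K Γ a
    obtain ⟨b, rfl⟩ := mk_surjective K Γ b
    simp only [smul_eq_mul, ← mk_smul, ← mk_mul, smul_mul_assoc]

instance : SMulCommClass K (LeavittPathAlgebra K Γ) (LeavittPathAlgebra K Γ) where
  smul_comm k a b := by
    obtain ⟨a, rfl⟩ := mk_surjective K Γ a
    obtain ⟨b, rfl⟩ := mk_surjective K Γ b
    simp only [smul_eq_mul, ← mk_smul, ← mk_mul, mul_smul_comm]

theorem mk_eq_of_rel {a b : FreeAlg K V E} (h : LeavittRel K Γ a b) : mk K Γ a = mk K Γ b :=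
  (mk_eq K Γ).2 (RingConGen.Rel.of _ _ ⟨1, a, b, h, (one_smul K a).symm, (one_smul K b).symm⟩)

theorem vertex_mul_vertex_self (x : V) : vertex K Γ x * vertex K Γ x = vertex K Γ x :=
  mk_eq_of_rel (.vertex_idem x)

theorem vertex_mul_vertex_of_ne {x y : V} (h : x ≠ y) : vertex K Γ x * vertex K Γ y = 0 :=
  mk_eq_of_rel (.vertex_orth x y h)

theorem source_mul_edge (f : E) : vertex K Γ (Γ.s f) * edge K Γ f = edge K Γ f :=
  mk_eq_of_rel (.source_edge f)

theorem edge_mul_range (f : E) : edge K Γ f * vertex K Γ (Γ.r f) = edge K Γ f :=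
  mk_eq_of_rel (.edge_range f)

theorem range_mul_ghost (f : E) : vertex K Γ (Γ.r f) * ghost K Γ f = ghost K Γ f :=
  mk_eq_of_rel (.range_ghost f)

theorem ghost_mul_source (f : E) : ghost K Γ f * vertex K Γ (Γ.s f) = ghost K Γ f :=
  mk_eq_of_rel (.ghost_source f)

theorem ghost_mul_edge_self (f : E) : ghost K Γ f * edge K Γ f = vertex K Γ (Γ.r f) :=
  mk_eq_of_rel (.ghost_edge f)

theorem ghost_mul_edge_of_ne {f f' : E} (h : f ≠ f') : ghost K Γ f * edge K Γ f' = 0 :=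
  mk_eq_of_rel (.ghost_edge_ne f f' h)

theorem vertex_eq_sum {x : V} {F : Finset E} (hne : F.Nonempty) (hF : ∀ f, f ∈ F ↔ Γ.s f = x) :
    vertex K Γ x = ∑ f ∈ F, edge K Γ f * ghost K Γ f := by
  let π : FreeAlg K V E →+ LeavittPathAlgebra K Γ :=
    { toFun := mk K Γ, map_zero' := rfl, map_add' := fun _ _ => rfl }
  exact (mk_eq_of_rel (.sum_edges x F hne hF)).trans (map_sum π _ _)

theorem vertex_mul_edge_of_ne {x : V} {f : E} (h : x ≠ Γ.s f) :
    vertex K Γ x * edge K Γ f = 0 := by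
  rw [← source_mul_edge, ← mul_assoc, vertex_mul_vertex_of_ne h, zero_mul]

theorem ghost_mul_vertex_of_ne {x : V} {f : E} (h : Γ.s f ≠ x) :
    ghost K Γ f * vertex K Γ x = 0 := by
  rw [← ghost_mul_source, mul_assoc, vertex_mul_vertex_of_ne h, mul_zero]

variable (K Γ) in
/-- Left multiplication by a path. -/
noncomputable def pathMul : List E → LeavittPathAlgebra K Γ →ₗ[K] LeavittPathAlgebra K Γ
  | [] => LinearMap.id
  | f :: a => LinearMap.mulLeft K (edge K Γ f) ∘ₗ pathMul a

variable (K Γ) in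
/-- Right multiplication by the ghost of a path. -/
noncomputable def mulGhost : List E → LeavittPathAlgebra K Γ →ₗ[K] LeavittPathAlgebra K Γ
  | [] => LinearMap.id
  | f :: b => LinearMap.mulRight K (ghost K Γ f) ∘ₗ mulGhost b

variable (K Γ) in
/-- The element `a x b*`, for lists of edges `a` and `b` and a vertex `x`. -/
noncomputable def monomial (a : List E) (x : V) (b : List E) : LeavittPathAlgebra K Γ :=
  pathMul K Γ a (mulGhost K Γ b (vertex K Γ x))

theorem pathMul_nil (y : LeavittPathAlgebra K Γ) : pathMul K Γ [] y = y := rfl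

theorem pathMul_cons (f : E) (a : List E) (y : LeavittPathAlgebra K Γ) :
    pathMul K Γ (f :: a) y = edge K Γ f * pathMul K Γ a y := rfl

theorem mulGhost_nil (y : LeavittPathAlgebra K Γ) : mulGhost K Γ [] y = y := rfl

theorem mulGhost_cons (f : E) (b : List E) (y : LeavittPathAlgebra K Γ) :
    mulGhost K Γ (f :: b) y = mulGhost K Γ b y * ghost K Γ f := rfl

theorem pathMul_append (a a' : List E) (y : LeavittPathAlgebra K Γ) :
    pathMul K Γ (a ++ a') y = pathMul K Γ a (pathMul K Γ a' y) := by
  induction a with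
  | nil => rfl
  | cons f a ih => rw [List.cons_append, pathMul_cons, pathMul_cons, ih]

theorem mulGhost_append (b b' : List E) (y : LeavittPathAlgebra K Γ) :
    mulGhost K Γ (b ++ b') y = mulGhost K Γ b (mulGhost K Γ b' y) := by
  induction b with
  | nil => rfl
  | cons f b ih => rw [List.cons_append, mulGhost_cons, mulGhost_cons, ih]

theorem pathMul_mul (a : List E) (x y : LeavittPathAlgebra K Γ) :
    pathMul K Γ a x * y = pathMul K Γ a (x * y) := by
  induction a with
  | nil => rfl
  | cons f a ih => rw [pathMul_cons, pathMul_cons, mul_assoc, ih]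

theorem mul_mulGhost (b : List E) (x y : LeavittPathAlgebra K Γ) :
    x * mulGhost K Γ b y = mulGhost K Γ b (x * y) := by
  induction b with
  | nil => rfl
  | cons f b ih => rw [mulGhost_cons, mulGhost_cons, ← mul_assoc, ih]

theorem mulGhost_pathMul (a b : List E) (y : LeavittPathAlgebra K Γ) :
    mulGhost K Γ b (pathMul K Γ a y) = pathMul K Γ a (mulGhost K Γ b y) := by
  induction b with
  | nil => rfl
  | cons f b ih => rw [mulGhost_cons, mulGhost_cons, ih, pathMul_mul]

theorem edge_mul_monomial (f : E) (a : List E) (x : V) (b : List E) :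
    edge K Γ f * monomial K Γ a x b = monomial K Γ (f :: a) x b := rfl

theorem monomial_mul_ghost (f : E) (a : List E) (x : V) (b : List E) :
    monomial K Γ a x b * ghost K Γ f = monomial K Γ a x (f :: b) :=
  pathMul_mul a _ _

theorem monomial_append (a b d : List E) (x : V) :
    monomial K Γ (a ++ d) x (b ++ d) =
      pathMul K Γ a (mulGhost K Γ b (monomial K Γ d x d)) := by
  simp only [monomial, pathMul_append, mulGhost_append, mulGhost_pathMul]

/-- Lists of edges are not required to be composable. The alternative "zero or unchanged" is all
that the later inductions need, and it avoids carrying path hypotheses. The list must be nonempty,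
since `z` is arbitrary. -/
theorem vertex_mul_pathMul_cons (y : V) (f : E) (a : List E) (z : LeavittPathAlgebra K Γ) :
    vertex K Γ y * pathMul K Γ (f :: a) z = 0 ∨
      vertex K Γ y * pathMul K Γ (f :: a) z = pathMul K Γ (f :: a) z := by
  rw [pathMul_cons, ← mul_assoc]
  rcases eq_or_ne y (Γ.s f) with rfl | h
  · exact Or.inr (by rw [source_mul_edge])
  · exact Or.inl (by rw [vertex_mul_edge_of_ne h, zero_mul])

theorem mulGhost_cons_mul_vertex (y : V) (f : E) (b : List E) (z : LeavittPathAlgebra K Γ) :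
    mulGhost K Γ (f :: b) z * vertex K Γ y = 0 ∨
      mulGhost K Γ (f :: b) z * vertex K Γ y = mulGhost K Γ (f :: b) z := by
  rw [mulGhost_cons, mul_assoc]
  rcases eq_or_ne (Γ.s f) y with rfl | h
  · exact Or.inr (by rw [ghost_mul_source])
  · exact Or.inl (by rw [ghost_mul_vertex_of_ne h, mul_zero])

theorem vertex_mul_monomial (y : V) (a : List E) (x : V) (b : List E) :
    vertex K Γ y * monomial K Γ a x b = 0 ∨
      vertex K Γ y * monomial K Γ a x b = monomial K Γ a x b := by
  cases a with
  | nil =>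
    simp only [monomial, pathMul_nil, mul_mulGhost]
    rcases eq_or_ne y x with rfl | h
    · exact Or.inr (by rw [vertex_mul_vertex_self])
    · exact Or.inl (by rw [vertex_mul_vertex_of_ne h, map_zero])
  | cons f a => exact vertex_mul_pathMul_cons y f a _

theorem monomial_mul_vertex (y : V) (a : List E) (x : V) (b : List E) :
    monomial K Γ a x b * vertex K Γ y = 0 ∨
      monomial K Γ a x b * vertex K Γ y = monomial K Γ a x b := by
  simp only [monomial, pathMul_mul]
  cases b with
  | nil =>
    simp only [mulGhost_nil]
    rcases eq_or_ne x y with rfl | h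
    · exact Or.inr (by rw [vertex_mul_vertex_self])
    · exact Or.inl (by rw [vertex_mul_vertex_of_ne h, map_zero])
  | cons f b =>
    rcases mulGhost_cons_mul_vertex (K := K) (Γ := Γ) y f b (vertex K Γ x) with h | h
    · exact Or.inl (by rw [h, map_zero])
    · exact Or.inr (by rw [h])

/-- The ghost either meets the first edge of `a`, where `f* f' = δ r(f)` applies, or, if `a` is
empty, joins the ghost part. -/
theorem ghost_mul_monomial (f : E) (a : List E) (x : V) (b : List E) :
    ghost K Γ f * monomial K Γ a x b = 0 ∨
      ∃ a' x' b', ghost K Γ f * monomial K Γ a x b = monomial K Γ a' x' b' := by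
  cases a with
  | nil =>
    simp only [monomial, pathMul_nil, mul_mulGhost]
    rcases eq_or_ne (Γ.s f) x with rfl | h
    -- Since `f* b* = (b f)*`, the edge is appended at the end of `b`.
    · refine Or.inr ⟨[], Γ.r f, b ++ [f], ?_⟩
      rw [ghost_mul_source, pathMul_nil, mulGhost_append, mulGhost_cons, mulGhost_nil,
        range_mul_ghost]
    · exact Or.inl (by rw [ghost_mul_vertex_of_ne h, map_zero])
  | cons f' a =>
    rw [← edge_mul_monomial, ← mul_assoc]
    rcases eq_or_ne f f' with rfl | h
    · rw [ghost_mul_edge_self]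
      exact (vertex_mul_monomial _ a x b).imp_right fun h => ⟨a, x, b, h⟩
    · exact Or.inl (by rw [ghost_mul_edge_of_ne h, zero_mul])

variable (K Γ) in
/-- The set of all monomials `a x b*`. -/
def monomials : Set (LeavittPathAlgebra K Γ) := {z | ∃ a x b, z = monomial K Γ a x b}

theorem gen_mul_mem_span (g : Gen V E) {z : LeavittPathAlgebra K Γ}
    (hz : z ∈ Submodule.span K (monomials K Γ)) :
    mk K Γ (gen K g) * z ∈ Submodule.span K (monomials K Γ) := by
  have hle : Submodule.span K (monomials K Γ) ≤ (Submodule.span K (monomials K Γ)).comap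
      (LinearMap.mulLeft K (mk K Γ (gen K g))) := by
    rw [Submodule.span_le]
    rintro _ ⟨a, x, b, rfl⟩
    show mk K Γ (gen K g) * monomial K Γ a x b ∈ Submodule.span K (monomials K Γ)
    cases g with
    | vertex y =>
      rcases vertex_mul_monomial (K := K) (Γ := Γ) y a x b with h | h
      · exact h ▸ zero_mem _
      · exact Submodule.subset_span ⟨a, x, b, h⟩
    | edge f => exact Submodule.subset_span ⟨f :: a, x, b, rfl⟩
    | ghost f =>
      rcases ghost_mul_monomial (K := K) (Γ := Γ) f a x b with h | ⟨a', x', b', h⟩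
      · exact h ▸ zero_mem _
      · exact Submodule.subset_span ⟨a', x', b', h⟩
  exact hle hz

theorem gen_mem_span (g : Gen V E) :
    mk K Γ (gen K g) ∈ Submodule.span K (monomials K Γ) := by
  apply Submodule.subset_span
  cases g with
  | vertex x => exact ⟨[], x, [], rfl⟩
  | edge f => exact ⟨[f], Γ.r f, [], (edge_mul_range f).symm⟩
  | ghost f => exact ⟨[], Γ.r f, [f], (range_mul_ghost f).symm⟩

/-- The monomials span the Leavitt path algebra. -/
theorem span_monomials : Submodule.span K (monomials K Γ) = ⊤ := by
  have hword : ∀ s : FreeSemigroup (Gen V E),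
      mk K Γ (MonoidAlgebra.single s 1) ∈ Submodule.span K (monomials K Γ) := by
    intro s
    induction s using FreeSemigroup.recOnMul with
    | ih1 g => exact gen_mem_span g
    | ih2 g s _ h =>
      have : (MonoidAlgebra.single (FreeSemigroup.of g * s) 1 : FreeAlg K V E) =
          gen K g * MonoidAlgebra.single s 1 := by
        rw [gen, MonoidAlgebra.single_mul_single, one_mul]
      rw [this, mk_mul]
      exact gen_mul_mem_span g h
  rw [eq_top_iff]
  rintro z -
  obtain ⟨z, rfl⟩ := mk_surjective K Γ z
  induction z using MonoidAlgebra.induction_linear with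
  | zero => exact zero_mem _
  | add a b ha hb => exact add_mem ha hb
  | single s k =>
    have : (MonoidAlgebra.single s k : FreeAlg K V E) = k • MonoidAlgebra.single s 1 := by
      rw [MonoidAlgebra.smul_single, smul_eq_mul, mul_one]
    rw [this, mk_smul]
    exact Submodule.smul_mem _ _ (hword s)

/-! ### The diagonal subalgebra -/

variable (K Γ) in
/-- The span of the elements `d x d*`, for paths `d` of length at most `n`. -/
noncomputable def diagonal (n : ℕ) : Submodule K (LeavittPathAlgebra K Γ) :=
  Submodule.span K {z | ∃ d x, d.length ≤ n ∧ z = monomial K Γ d x d}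

theorem diagonal_mono : Monotone (diagonal K Γ) := fun _ _ h =>
  Submodule.span_mono fun _ ⟨d, x, hd, hz⟩ => ⟨d, x, hd.trans h, hz⟩

theorem vertex_mul_mem_diagonal (y : V) {n : ℕ} {z : LeavittPathAlgebra K Γ}
    (hz : z ∈ diagonal K Γ n) : vertex K Γ y * z ∈ diagonal K Γ n := by
  have hle : diagonal K Γ n ≤ (diagonal K Γ n).comap
      (LinearMap.mulLeft K (vertex K Γ y)) := by
    rw [diagonal, Submodule.span_le]
    rintro _ ⟨d, x, hd, rfl⟩
    show vertex K Γ y * monomial K Γ d x d ∈ diagonal K Γ n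
    rcases vertex_mul_monomial (K := K) (Γ := Γ) y d x d with h | h
    · exact h ▸ zero_mem _
    · exact Submodule.subset_span ⟨d, x, hd, h⟩
  exact hle hz

theorem mul_vertex_mem_diagonal (y : V) {n : ℕ} {z : LeavittPathAlgebra K Γ}
    (hz : z ∈ diagonal K Γ n) : z * vertex K Γ y ∈ diagonal K Γ n := by
  have hle : diagonal K Γ n ≤ (diagonal K Γ n).comap
      (LinearMap.mulRight K (vertex K Γ y)) := by
    rw [diagonal, Submodule.span_le]
    rintro _ ⟨d, x, hd, rfl⟩
    show monomial K Γ d x d * vertex K Γ y ∈ diagonal K Γ n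
    rcases monomial_mul_vertex (K := K) (Γ := Γ) y d x d with h | h
    · exact h ▸ zero_mem _
    · exact Submodule.subset_span ⟨d, x, hd, h⟩
  exact hle hz

/-- The sum of the elements `f z f*`. -/
noncomputable def edgeSum (t : E →₀ LeavittPathAlgebra K Γ) : LeavittPathAlgebra K Γ :=
  t.sum fun f z => edge K Γ f * z * ghost K Γ f

theorem edgeSum_add (t t' : E →₀ LeavittPathAlgebra K Γ) :
    edgeSum (t + t') = edgeSum t + edgeSum t' :=
  Finsupp.sum_add_index' (fun f => by rw [mul_zero, zero_mul])
    fun f z z' => by rw [mul_add, add_mul]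

theorem edgeSum_smul (k : K) (t : E →₀ LeavittPathAlgebra K Γ) :
    edgeSum (k • t) = k • edgeSum t := by
  rw [edgeSum, Finsupp.sum_smul_index' (fun f => by rw [mul_zero, zero_mul]), edgeSum,
    Finsupp.smul_sum]
  simp only [mul_smul_comm, smul_mul_assoc]

theorem edgeSum_single (f : E) (z : LeavittPathAlgebra K Γ) :
    edgeSum (Finsupp.single f z) = edge K Γ f * z * ghost K Γ f :=
  Finsupp.sum_single_index (by rw [mul_zero, zero_mul])

/-- Generators `d x d*` with `d` empty are vertices; from the others the first edge of `d` is peeled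
off on both sides, which lowers the level. The finiteness of the support of `t` is what later bounds
the number of edges leaving a vertex in the support of `c`. -/
theorem exists_of_mem_diagonal_succ {n : ℕ} {y : LeavittPathAlgebra K Γ}
    (hy : y ∈ diagonal K Γ (n + 1)) :
    ∃ (c : V →₀ K) (t : E →₀ LeavittPathAlgebra K Γ), (∀ f, t f ∈ diagonal K Γ n) ∧
      y = Finsupp.linearCombination K (vertex K Γ) c + edgeSum t := by
  induction hy using Submodule.span_induction with
  | mem z hz =>
    obtain ⟨d, x, hd, rfl⟩ := hz
    cases d with
    | nil =>
      refine ⟨Finsupp.single x 1, 0, fun f => zero_mem _, ?_⟩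
      rw [Finsupp.linearCombination_single, one_smul, edgeSum, Finsupp.sum_zero_index, add_zero]
      rfl
    | cons f d =>
      refine ⟨0, Finsupp.single f (monomial K Γ d x d), fun f' => ?_, ?_⟩
      · rcases eq_or_ne f f' with rfl | h
        · rw [Finsupp.single_eq_same]
          exact Submodule.subset_span ⟨d, x, Nat.le_of_succ_le_succ hd, rfl⟩
        · rw [Finsupp.single_eq_of_ne' h]
          exact zero_mem _
      · rw [map_zero, zero_add, edgeSum_single, edge_mul_monomial, monomial_mul_ghost]
  | zero => exact ⟨0, 0, fun f => zero_mem _, by simp [edgeSum]⟩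
  | add y y' _ _ h h' =>
    obtain ⟨c, t, ht, rfl⟩ := h
    obtain ⟨c', t', ht', rfl⟩ := h'
    exact ⟨c + c', t + t', fun f => add_mem (ht f) (ht' f), by
      rw [map_add, edgeSum_add, add_add_add_comm]⟩
  | smul k y _ h =>
    obtain ⟨c, t, ht, rfl⟩ := h
    exact ⟨k • c, k • t, fun f => Submodule.smul_mem _ _ (ht f), by
      rw [map_smul, edgeSum_smul, smul_add]⟩

theorem vertex_mul_linearCombination (x : V) (c : V →₀ K) :
    vertex K Γ x * Finsupp.linearCombination K (vertex K Γ) c = c x • vertex K Γ x := by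
  classical
  rw [Finsupp.linearCombination_apply, Finsupp.sum, Finset.mul_sum, Finset.sum_eq_single x]
  · rw [mul_smul_comm, vertex_mul_vertex_self]
  · intro y _ hy
    rw [mul_smul_comm, vertex_mul_vertex_of_ne hy.symm, smul_zero]
  · intro h
    rw [Finsupp.notMem_support_iff.1 h, zero_smul, mul_zero]

/-- Orthogonality of distinct edges kills every term but the one at `f`. The compression `y ↦ f* y
f` is the inductive step on the diagonal. -/
theorem ghost_mul_edgeSum_mul_edge (f : E) (t : E →₀ LeavittPathAlgebra K Γ) :
    ghost K Γ f * edgeSum t * edge K Γ f =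
      vertex K Γ (Γ.r f) * t f * vertex K Γ (Γ.r f) := by
  have key : ∀ (f' : E) (z : LeavittPathAlgebra K Γ),
      ghost K Γ f * (edge K Γ f' * z * ghost K Γ f') * edge K Γ f =
        (ghost K Γ f * edge K Γ f') * z * (ghost K Γ f' * edge K Γ f) :=
    fun f' z => by simp only [mul_assoc]
  rw [edgeSum, Finsupp.sum, Finset.mul_sum, Finset.sum_mul, Finset.sum_eq_single f]
  · rw [key, ghost_mul_edge_self]
  · intro f' _ hf
    rw [key, ghost_mul_edge_of_ne hf.symm, zero_mul, zero_mul]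
  · intro h
    rw [Finsupp.notMem_support_iff.1 h, mul_zero, zero_mul, mul_zero, zero_mul]

theorem ghost_mul_linearCombination_mul_edge (f : E) (c : V →₀ K) :
    ghost K Γ f * Finsupp.linearCombination K (vertex K Γ) c * edge K Γ f =
      c (Γ.s f) • vertex K Γ (Γ.r f) := by
  rw [← ghost_mul_source, mul_assoc (ghost K Γ f), vertex_mul_linearCombination, mul_smul_comm,
    smul_mul_assoc, ghost_mul_source, ghost_mul_edge_self]

theorem vertex_mul_edgeSum_of_isSink {x : V} (hx : Γ.IsSink x)
    (t : E →₀ LeavittPathAlgebra K Γ) : vertex K Γ x * edgeSum t = 0 := by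
  rw [edgeSum, Finsupp.sum, Finset.mul_sum]
  refine Finset.sum_eq_zero fun f _ => ?_
  rw [← mul_assoc, ← mul_assoc, vertex_mul_edge_of_ne (hx f).symm, zero_mul, zero_mul]

theorem vertex_ne_zero (x : V) : vertex K Γ x ≠ 0 := fun h =>
  vertexDelta_ne_zero (K := K) (Γ := Γ) x (by rw [← toSkewRing_vertex, h, map_zero])

/-- A combination `∑ c_x x - ∑ c_{s(f)} f f*` vanishes if the second sum extends over all edges that
start in the support of `c`, and no sink is in the support of `c`. -/
theorem linearCombination_eq_sum {c : V →₀ K} {F : Finset E}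
    (hF : ∀ f, c (Γ.s f) ≠ 0 → f ∈ F) (hsink : ∀ x, Γ.IsSink x → c x = 0) :
    Finsupp.linearCombination K (vertex K Γ) c =
      ∑ f ∈ F, c (Γ.s f) • (edge K Γ f * ghost K Γ f) := by
  classical
  have h1 : ∑ f ∈ F, c (Γ.s f) • (edge K Γ f * ghost K Γ f) =
      ∑ f ∈ F with Γ.s f ∈ c.support, c (Γ.s f) • (edge K Γ f * ghost K Γ f) := by
    refine (Finset.sum_filter_of_ne fun f _ h => ?_).symm
    exact Finsupp.mem_support_iff.2 fun h0 => h (by rw [h0, zero_smul])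
  rw [h1, ← Finset.sum_fiberwise_of_maps_to (s := {f ∈ F | Γ.s f ∈ c.support}) (t := c.support)
    (g := Γ.s) fun f hf => (Finset.mem_filter.1 hf).2]
  rw [Finsupp.linearCombination_apply, Finsupp.sum]
  refine Finset.sum_congr rfl fun x hx => ?_
  have hc : c x ≠ 0 := Finsupp.mem_support_iff.1 hx
  -- As `c x ≠ 0`, all edges leaving `x` belong to `F`, so this fibre is the whole of `s⁻¹(x)`. It
  -- is finite, and nonempty because `x` is not a sink, so the sum relation applies at `x`.
  have hmem : ∀ f, f ∈ ({f ∈ ({f ∈ F | Γ.s f ∈ c.support} : Finset E) | Γ.s f = x} : Finset E) ↔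
      Γ.s f = x := fun f => by
    simp only [Finset.mem_filter]
    refine ⟨fun h => h.2, fun h => ⟨⟨hF f (by rw [h]; exact hc), by rw [h]; exact hx⟩, h⟩⟩
  have hne : ({f ∈ ({f ∈ F | Γ.s f ∈ c.support} : Finset E) | Γ.s f = x} : Finset E).Nonempty := by
    have : ¬ Γ.IsSink x := fun h => hc (hsink x h)
    simp only [IsSink, not_forall, not_not] at this
    obtain ⟨f, hf⟩ := this
    exact ⟨f, (hmem f).2 hf⟩
  rw [vertex_eq_sum hne hmem, Finset.smul_sum]
  exact Finset.sum_congr rfl fun f hf => by rw [(hmem f).1 hf]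

/-! ### Vanishing of kernel elements, on the diagonal and between paths -/

theorem eq_zero_of_smul_vertex {k : K} {x : V}
    (h : toSkewRing K Γ (k • vertex K Γ x) = 0) : k = 0 := by
  rw [map_smul, toSkewRing_vertex] at h
  exact (smul_eq_zero.1 h).resolve_right (vertexDelta_ne_zero x)

/-- The canonical homomorphism is injective on the diagonal. -/
theorem eq_zero_of_mem_diagonal {n : ℕ} {y : LeavittPathAlgebra K Γ}
    (hy : y ∈ diagonal K Γ n) (h : toSkewRing K Γ y = 0) : y = 0 := by
  induction n generalizing y with
  | zero =>
    have hy' : y ∈ Submodule.span K (Set.range (vertex K Γ)) := by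
      refine Submodule.span_mono ?_ hy
      rintro _ ⟨d, x, hd, rfl⟩
      obtain rfl := List.eq_nil_of_length_eq_zero (Nat.le_zero.1 hd)
      exact ⟨x, rfl⟩
    obtain ⟨c, rfl⟩ := (Finsupp.mem_span_range_iff_exists_finsupp).1 hy'
    change toSkewRing K Γ (Finsupp.linearCombination K (vertex K Γ) c) = 0 at h
    show Finsupp.linearCombination K (vertex K Γ) c = 0
    -- Multiplication by the vertex `x` isolates the coefficient `c x`.
    have hc : c = 0 := Finsupp.ext fun x => eq_zero_of_smul_vertex (Γ := Γ) (x := x) (by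
      rw [← vertex_mul_linearCombination, map_mul, h, mul_zero])
    rw [hc, map_zero]
  | succ n ih =>
    obtain ⟨c, t, ht, rfl⟩ := exists_of_mem_diagonal_succ hy
    -- The left side is `f* y f`. It has level `n` and lies in the kernel along with `y`.
    have hf : ∀ f, c (Γ.s f) • vertex K Γ (Γ.r f) +
        vertex K Γ (Γ.r f) * t f * vertex K Γ (Γ.r f) = 0 := fun f => by
      apply ih
      · refine add_mem (Submodule.smul_mem _ _ ?_)
          (mul_vertex_mem_diagonal _ (vertex_mul_mem_diagonal _ (ht f)))
        exact Submodule.subset_span ⟨[], Γ.r f, Nat.zero_le n, rfl⟩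
      · rw [← ghost_mul_linearCombination_mul_edge, ← ghost_mul_edgeSum_mul_edge, ← add_mul,
          ← mul_add, map_mul, map_mul, h, mul_zero, zero_mul]
    -- Multiplying the previous identity by `f` and `f*` again shows `f t_f f* = -c_{s(f)} f f*`.
    have hsum : edgeSum t = -∑ f ∈ t.support, c (Γ.s f) • (edge K Γ f * ghost K Γ f) := by
      rw [edgeSum, Finsupp.sum, ← Finset.sum_neg_distrib]
      refine Finset.sum_congr rfl fun f _ => ?_
      have e : edge K Γ f * t f * ghost K Γ f =
          edge K Γ f * (vertex K Γ (Γ.r f) * t f * vertex K Γ (Γ.r f)) * ghost K Γ f := by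
        nth_rewrite 1 [← edge_mul_range f, ← range_mul_ghost f]
        simp only [mul_assoc]
      rw [e, eq_neg_of_add_eq_zero_right (hf f), mul_neg, neg_mul, mul_smul_comm, smul_mul_assoc,
        edge_mul_range]
    rw [hsum, ← sub_eq_add_neg, sub_eq_zero]
    refine linearCombination_eq_sum (fun f hc => ?_) fun x hx => ?_
    -- If `t f = 0`, the compressed identity reads `c_{s(f)} r(f) = 0`, so `c_{s(f)} = 0`. Thus the
    -- edges leaving the support of `c` all lie in the finite support of `t`, and no infinite
    -- emitter occurs in `c`.
    · rw [Finsupp.mem_support_iff]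
      intro h0
      have := hf f
      rw [h0, mul_zero, zero_mul, add_zero] at this
      exact (smul_eq_zero.1 this).elim hc (vertex_ne_zero _)
    -- At a sink `x` every product `x f` is zero, so `x y = c_x x` lies in the kernel.
    · refine eq_zero_of_smul_vertex (Γ := Γ) (x := x) ?_
      rw [← vertex_mul_linearCombination, ← add_zero (_ * _), ← vertex_mul_edgeSum_of_isSink hx t,
        ← mul_add, map_mul, h, mul_zero]

/-- Right multiplication by `f` turns a final ghost `f*` into `r(f)`, so the ghosts can be removed
one by one inside the kernel, and `r(f) f* = f*` puts them back. The leftover vertex is absorbed by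
the next ghost or kills the product; once no ghost is left it is absorbed into the diagonal element.
-/
theorem mulGhost_eq_zero {n : ℕ} (b : List E) {y : LeavittPathAlgebra K Γ}
    (hy : y ∈ diagonal K Γ n) (h : toSkewRing K Γ (mulGhost K Γ b y) = 0) :
    mulGhost K Γ b y = 0 := by
  induction b generalizing y with
  | nil => exact eq_zero_of_mem_diagonal hy h
  | cons f b ih =>
    have h' : toSkewRing K Γ (mulGhost K Γ b y * vertex K Γ (Γ.r f)) = 0 := by
      rw [← ghost_mul_edge_self, ← mul_assoc, ← mulGhost_cons, map_mul, h, zero_mul]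
    have h0 : mulGhost K Γ b y * vertex K Γ (Γ.r f) = 0 := by
      cases b with
      | nil => exact ih (mul_vertex_mem_diagonal _ hy) h'
      | cons f' b =>
        rcases mulGhost_cons_mul_vertex (Γ.r f) f' b y with e | e
        · exact e
        · rw [e] at h' ⊢
          exact ih hy h'
    rw [mulGhost_cons, ← range_mul_ghost, ← mul_assoc, h0, zero_mul]

/-- The mirror argument strips off `a` by left multiplication with ghosts, and ends in
`mulGhost_eq_zero`. -/
theorem pathMul_mulGhost_eq_zero {n : ℕ} (a b : List E) {y : LeavittPathAlgebra K Γ}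
    (hy : y ∈ diagonal K Γ n) (h : toSkewRing K Γ (pathMul K Γ a (mulGhost K Γ b y)) = 0) :
    pathMul K Γ a (mulGhost K Γ b y) = 0 := by
  induction a generalizing y with
  | nil => exact mulGhost_eq_zero b hy h
  | cons f a ih =>
    have h' : toSkewRing K Γ (vertex K Γ (Γ.r f) * pathMul K Γ a (mulGhost K Γ b y)) = 0 := by
      rw [← ghost_mul_edge_self, mul_assoc, ← pathMul_cons, map_mul, h, mul_zero]
    have h0 : vertex K Γ (Γ.r f) * pathMul K Γ a (mulGhost K Γ b y) = 0 := by
      cases a with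
      | nil =>
        rw [pathMul_nil, mul_mulGhost] at h' ⊢
        exact ih (vertex_mul_mem_diagonal _ hy) h'
      | cons f' a =>
        rcases vertex_mul_pathMul_cons (Γ.r f) f' a (mulGhost K Γ b y) with e | e
        · exact e
        · rw [e] at h' ⊢
          exact ih hy h'
    rw [pathMul_cons, ← edge_mul_range, mul_assoc, h0, mul_zero]

end LeavittPathAlgebra

end DirectedGraph

/-! ### Homogeneous components -/

namespace PartialAction.SkewGroupRing

variable {K : Type*} {G : Type*} {R : Type*} [CommRing K] [Group G] [NonUnitalRing R] [Module K R]
  [IsScalarTower K R R] [SMulCommClass K R R] {P : PartialAction K G R}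

theorem mul_mem_component {g h : G} {a b : P.SkewGroupRing} (ha : a ∈ component P g)
    (hb : b ∈ component P h) : a * b ∈ component P (g * h) := by
  obtain ⟨r, rfl⟩ := ha
  obtain ⟨r', rfl⟩ := hb
  rw [single_mul_single]
  exact ⟨_, rfl⟩

theorem coeff_of_mem_component {g h : G} (hgh : g ≠ h) {a : P.SkewGroupRing}
    (ha : a ∈ component P g) : coeff P h a = 0 := by
  obtain ⟨r, rfl⟩ := ha
  exact coeff_single_of_ne P hgh r

theorem eq_zero_of_coeff {g : G} {a : P.SkewGroupRing} (ha : a ∈ component P g)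
    (h : coeff P g a = 0) : a = 0 := by
  obtain ⟨r, rfl⟩ := ha
  rw [coeff_single_self] at h
  rw [h, map_zero]

theorem eq_zero_of_mem_component {g h : G} (hgh : g ≠ h) {a : P.SkewGroupRing}
    (ha : a ∈ component P g) (ha' : a ∈ component P h) : a = 0 :=
  eq_zero_of_coeff ha' (coeff_of_mem_component hgh ha)

open Classical in
/-- The preimages of the homogeneous components under an isomorphism form a direct sum
decomposition. -/
theorem isInternal_comap {L : Type*} [AddCommGroup L] (φ : L ≃+ P.SkewGroupRing) :
    DirectSum.IsInternal fun g => (component P g).toAddSubgroup.comap φ.toAddMonoidHom := by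
  let e : ∀ g, P.D g ≃+ (component P g).toAddSubgroup.comap φ.toAddMonoidHom := fun g =>
    AddEquiv.ofBijective
      ((φ.symm.toAddMonoidHom.comp (single P g).toAddMonoidHom).codRestrict
        ((component P g).toAddSubgroup.comap φ.toAddMonoidHom) fun r => by
          show φ (φ.symm (single P g r)) ∈ component P g
          rw [φ.apply_symm_apply]; exact ⟨r, rfl⟩)
      ⟨fun r r' h => single_injective P g (φ.symm.injective (congrArg Subtype.val h)),
        fun ⟨x, r, hr⟩ => ⟨r, Subtype.ext (φ.symm_apply_eq.2 hr)⟩⟩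
  let E : (DirectSum G fun g => P.D g) ≃+ DirectSum G fun g =>
      (component P g).toAddSubgroup.comap φ.toAddMonoidHom := DFinsupp.mapRange.addEquiv e
  -- After identifying each preimage with `D_g`, the summation map is `φ⁻¹`, because the two agree
  -- on every `r δ_g`. Its bijectivity follows.
  have hE : (DirectSum.coeAddMonoidHom fun g =>
      (component P g).toAddSubgroup.comap φ.toAddMonoidHom).comp E.toAddMonoidHom =
      φ.symm.toAddMonoidHom := by
    refine DirectSum.addHom_ext fun g r => ?_
    have h1 : E (DirectSum.of (fun g => P.D g) g r) = DirectSum.of _ g (e g r) :=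
      DFinsupp.mapRange_single (hf := fun i => map_zero (e i))
    show DirectSum.coeAddMonoidHom _ (E (DirectSum.of (fun g => P.D g) g r)) = _
    rw [h1, DirectSum.coeAddMonoidHom_of]
    rfl
  have hb : Function.Bijective ((DirectSum.coeAddMonoidHom fun g =>
      (component P g).toAddSubgroup.comap φ.toAddMonoidHom) ∘ E) := by
    have : ((DirectSum.coeAddMonoidHom fun g =>
      (component P g).toAddSubgroup.comap φ.toAddMonoidHom) ∘ E) = φ.symm :=
      funext fun z => DFunLike.congr_fun hE z
    rw [this]
    exact φ.symm.bijective
  exact (Function.Bijective.of_comp_iff _ E.bijective).1 hb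

end PartialAction.SkewGroupRing

namespace DirectedGraph

variable {V : Type u} {E : Type v}

open PartialAction.SkewGroupRing

/-! ### Reduced forms of the elements `a b⁻¹` -/

/-- The element of the free group represented by a list of edges. -/
def pathElt (a : List E) : FreeGroup E := FreeGroup.mk (a.map fun f => (f, true))

theorem pathElt_nil : pathElt ([] : List E) = 1 := rfl

theorem pathElt_append (a b : List E) : pathElt (a ++ b) = pathElt a * pathElt b := by
  simp only [pathElt, List.map_append, FreeGroup.mul_mk]

theorem pathElt_cons (f : E) (a : List E) : pathElt (f :: a) = FreeGroup.of f * pathElt a :=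
  pathElt_append [f] a

theorem mk_pathWord (a b : List E) : FreeGroup.mk (pathWord a b) = pathElt a * (pathElt b)⁻¹ := by
  simp only [pathElt, pathWord, FreeGroup.inv_mk, FreeGroup.mul_mk]

/-- Cancelling the longest common suffix of `a` and `b` brings `a b⁻¹` to reduced form. -/
theorem exists_isReduced_pathWord (a b : List E) :
    ∃ a' b' d : List E, a = a' ++ d ∧ b = b' ++ d ∧ FreeGroup.IsReduced (pathWord a' b') := by
  induction a using List.reverseRecOn generalizing b with
  | nil => exact ⟨[], b, [], rfl, (List.append_nil b).symm, isReduced_pathWord_nil_left b⟩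
  | append_singleton a f ih =>
    rcases List.eq_nil_or_concat' b with rfl | ⟨b, f', rfl⟩
    · exact ⟨a ++ [f], [], [], (List.append_nil _).symm, rfl, isReduced_pathWord_nil_right _⟩
    · rcases eq_or_ne f f' with rfl | hne
      · obtain ⟨a', b', d, rfl, rfl, h⟩ := ih b
        exact ⟨a', b', d ++ [f], List.append_assoc _ _ _, List.append_assoc _ _ _, h⟩
      · refine ⟨a ++ [f], b ++ [f'], [], (List.append_nil _).symm, (List.append_nil _).symm, ?_⟩
        have h1 := isReduced_pathWord_nil_right (a ++ [f])
        have h2 := isReduced_pathWord_nil_left (b ++ [f'])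
        -- Each half is reduced, so only the junction matters. There `f` meets `f'⁻¹`, and these do
        -- not cancel because `f ≠ f'`.
        refine List.isChain_append.2 ⟨by simpa [pathWord, FreeGroup.IsReduced] using h1,
          by simpa [pathWord, FreeGroup.IsReduced] using h2, fun p hp q hq h => ?_⟩
        simp [FreeGroup.invRev] at hp hq
        subst hp hq
        exact absurd h hne

theorem pathWord_eq_of_isReduced {a b a' b' : List E} (h : FreeGroup.IsReduced (pathWord a b))
    (h' : FreeGroup.IsReduced (pathWord a' b'))
    (he : pathElt a * (pathElt b)⁻¹ = pathElt a' * (pathElt b')⁻¹) : a = a' ∧ b = b' := by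
  classical
  rw [← mk_pathWord, ← mk_pathWord] at he
  have he' := congrArg FreeGroup.toWord he
  rw [FreeGroup.toWord_mk, FreeGroup.toWord_mk, h.reduce_eq, h'.reduce_eq] at he'
  exact pathWord_inj he'

variable {K : Type w} [Field K] {Γ : DirectedGraph V E}

theorem oneDelta_mem_component (g : FreeGroup E) (hg : g ≠ 1) :
    oneDelta K Γ g hg ∈ component (freeGroupAction K Γ) g := ⟨_, rfl⟩

theorem vertexDelta_mem_component (x : V) :
    vertexDelta K Γ x ∈ component (freeGroupAction K Γ) 1 := ⟨_, rfl⟩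

namespace LeavittPathAlgebra

/-! ### Injectivity -/

theorem toSkewRing_pathMul_mem (a : List E) {g : FreeGroup E} {z : LeavittPathAlgebra K Γ}
    (hz : toSkewRing K Γ z ∈ component (freeGroupAction K Γ) g) :
    toSkewRing K Γ (pathMul K Γ a z) ∈ component (freeGroupAction K Γ) (pathElt a * g) := by
  induction a with
  | nil => rwa [pathElt_nil, one_mul]
  | cons f a ih =>
    rw [pathMul_cons, map_mul, toSkewRing_edge, pathElt_cons, mul_assoc]
    exact mul_mem_component (oneDelta_mem_component _ _) ih

theorem toSkewRing_mulGhost_mem (b : List E) {g : FreeGroup E} {z : LeavittPathAlgebra K Γ}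
    (hz : toSkewRing K Γ z ∈ component (freeGroupAction K Γ) g) :
    toSkewRing K Γ (mulGhost K Γ b z) ∈
      component (freeGroupAction K Γ) (g * (pathElt b)⁻¹) := by
  induction b with
  | nil => rwa [pathElt_nil, inv_one, mul_one]
  | cons f b ih =>
    rw [mulGhost_cons, map_mul, toSkewRing_ghost, pathElt_cons, mul_inv_rev, ← mul_assoc]
    exact mul_mem_component ih (oneDelta_mem_component _ _)

variable (K Γ) in
/-- The span of the monomials `a x b*` with `a b⁻¹ = g` in the free group. -/
noncomputable def homogeneous (g : FreeGroup E) : Submodule K (LeavittPathAlgebra K Γ) :=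
  Submodule.span K {z | ∃ a x b, pathElt a * (pathElt b)⁻¹ = g ∧ z = monomial K Γ a x b}

theorem toSkewRing_mem_component {g : FreeGroup E} {z : LeavittPathAlgebra K Γ}
    (hz : z ∈ homogeneous K Γ g) : toSkewRing K Γ z ∈ component (freeGroupAction K Γ) g := by
  have hle : homogeneous K Γ g ≤ (component (freeGroupAction K Γ) g).comap
      (toSkewRing K Γ : LeavittPathAlgebra K Γ →ₗ[K] SkewRing K Γ) := by
    rw [homogeneous, Submodule.span_le]
    rintro _ ⟨a, x, b, rfl, rfl⟩
    have h1 : toSkewRing K Γ (vertex K Γ x) ∈ component (freeGroupAction K Γ) 1 := by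
      rw [toSkewRing_vertex]; exact vertexDelta_mem_component x
    have h2 := toSkewRing_pathMul_mem a (toSkewRing_mulGhost_mem b h1)
    rw [one_mul] at h2
    exact h2
  exact hle hz

/-- Cancelling a common suffix `d` rewrites a monomial of degree `g` as `a' (d x d*) b'*` with `a'
b'⁻¹` reduced. By uniqueness of reduced words `a'` and `b'` depend only on `g`, so they can be
factored out of linear combinations. -/
theorem exists_of_mem_homogeneous {g : FreeGroup E} {z : LeavittPathAlgebra K Γ}
    (hz : z ∈ homogeneous K Γ g) :
    ∃ (a b : List E) (n : ℕ), ∃ y ∈ diagonal K Γ n, z = pathMul K Γ a (mulGhost K Γ b y) := by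
  by_cases hg : ∃ a b : List E, FreeGroup.IsReduced (pathWord a b) ∧
      pathElt a * (pathElt b)⁻¹ = g
  · obtain ⟨a, b, hr, rfl⟩ := hg
    refine ⟨a, b, ?_⟩
    induction hz using Submodule.span_induction with
    | mem z hz =>
      obtain ⟨a₁, x, b₁, he, rfl⟩ := hz
      obtain ⟨a', b', d, rfl, rfl, hr'⟩ := exists_isReduced_pathWord a₁ b₁
      rw [pathElt_append, pathElt_append, mul_inv_rev, mul_assoc, mul_inv_cancel_left] at he
      obtain ⟨rfl, rfl⟩ := pathWord_eq_of_isReduced hr' hr he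
      exact ⟨d.length, monomial K Γ d x d, Submodule.subset_span ⟨d, x, le_rfl, rfl⟩,
        monomial_append a' b' d x⟩
    | zero => exact ⟨0, 0, zero_mem _, by rw [map_zero, map_zero]⟩
    | add z z' _ _ h h' =>
      obtain ⟨n, y, hy, rfl⟩ := h
      obtain ⟨n', y', hy', rfl⟩ := h'
      exact ⟨max n n', y + y', add_mem (diagonal_mono (le_max_left _ _) hy)
        (diagonal_mono (le_max_right _ _) hy'), by rw [map_add, map_add]⟩
    | smul k z _ h =>
      obtain ⟨n, y, hy, rfl⟩ := h
      exact ⟨n, k • y, Submodule.smul_mem _ _ hy, by rw [map_smul, map_smul]⟩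
  -- If `g` is not of the form `a b⁻¹`, there is no monomial of degree `g` at all.
  · have h0 : homogeneous K Γ g = ⊥ := by
      rw [homogeneous, Submodule.span_eq_bot]
      rintro _ ⟨a, x, b, he, rfl⟩
      obtain ⟨a', b', d, rfl, rfl, hr'⟩ := exists_isReduced_pathWord a b
      rw [pathElt_append, pathElt_append, mul_inv_rev, mul_assoc, mul_inv_cancel_left] at he
      exact absurd ⟨a', b', hr', he⟩ hg
    rw [h0, Submodule.mem_bot] at hz
    exact ⟨[], [], 0, 0, zero_mem _, hz⟩

theorem eq_zero_of_mem_homogeneous {g : FreeGroup E} {z : LeavittPathAlgebra K Γ}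
    (hz : z ∈ homogeneous K Γ g) (h : toSkewRing K Γ z = 0) : z = 0 := by
  obtain ⟨a, b, n, y, hy, rfl⟩ := exists_of_mem_homogeneous hz
  exact pathMul_mulGhost_eq_zero a b hy h

theorem exists_homogeneous_sum (z : LeavittPathAlgebra K Γ) :
    ∃ t : FreeGroup E →₀ LeavittPathAlgebra K Γ, (∀ g, t g ∈ homogeneous K Γ g) ∧
      z = t.sum fun _ y => y := by
  have hz : z ∈ Submodule.span K (monomials K Γ) := span_monomials (K := K) (Γ := Γ) ▸ trivial
  induction hz using Submodule.span_induction with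
  | mem z hz =>
    obtain ⟨a, x, b, rfl⟩ := hz
    refine ⟨Finsupp.single (pathElt a * (pathElt b)⁻¹) (monomial K Γ a x b), fun g => ?_,
      by rw [Finsupp.sum_single_index rfl]⟩
    rcases eq_or_ne (pathElt a * (pathElt b)⁻¹) g with rfl | h
    · rw [Finsupp.single_eq_same]
      exact Submodule.subset_span ⟨a, x, b, rfl, rfl⟩
    · rw [Finsupp.single_eq_of_ne' h]
      exact zero_mem _
  | zero => exact ⟨0, fun _ => zero_mem _, Finsupp.sum_zero_index.symm⟩
  | add z z' _ _ h h' =>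
    obtain ⟨t, ht, rfl⟩ := h
    obtain ⟨t', ht', rfl⟩ := h'
    exact ⟨t + t', fun g => add_mem (ht g) (ht' g),
      (Finsupp.sum_add_index' (fun _ => rfl) fun _ _ _ => rfl).symm⟩
  | smul k z _ h =>
    obtain ⟨t, ht, rfl⟩ := h
    exact ⟨k • t, fun g => Submodule.smul_mem _ _ (ht g), by
      rw [Finsupp.sum_smul_index' fun _ => rfl, Finsupp.smul_sum]⟩

/-- The homogeneous parts of an element have images in different components, so if the image of the
sum vanishes, each of them is in the kernel. -/
theorem toSkewRing_injective : Function.Injective (toSkewRing K Γ) := by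
  rw [injective_iff_map_eq_zero]
  intro z hz
  obtain ⟨t, ht, rfl⟩ := exists_homogeneous_sum z
  refine Finset.sum_eq_zero fun g hg => eq_zero_of_mem_homogeneous (ht g) ?_
  refine eq_zero_of_coeff (toSkewRing_mem_component (ht g)) ?_
  have h := congrArg (coeff (freeGroupAction K Γ) g) hz
  rw [map_zero, Finsupp.sum, map_sum, map_sum, Finset.sum_eq_single g] at h
  · exact h
  · exact fun g' _ hne => coeff_of_mem_component hne (toSkewRing_mem_component (ht g'))
  · exact fun h' => absurd hg h'

end LeavittPathAlgebra

/-! ### Surjectivity -/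

/-- In general the coefficient of the product is `1_g 1_{gh}`; the inclusion of domains removes the
factor `1_g`. -/
theorem oneDelta_mul_oneDelta {g h : FreeGroup E} (hg : g ≠ 1) (hh : h ≠ 1) (hgh : g * h ≠ 1)
    (hsub : Γ.domain (g * h) ⊆ Γ.domain g) :
    oneDelta K Γ g hg * oneDelta K Γ h hh = oneDelta K Γ (g * h) hgh := by
  refine single_mul_single_eq rfl ?_
  show char K Γ (Γ.domain g) * transport K Γ g (char K Γ (Γ.domain h)) =
    char K Γ (Γ.domain (g * h))
  rw [transport_char_mul]
  funext η
  by_cases hη : η ∈ Γ.domain g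
  · obtain ⟨ξ, hξ⟩ := mem_domain_iff.1 hη
    rw [transport_apply hξ]
    by_cases hξ' : ξ ∈ Γ.domain h
    · rw [char_of_mem hξ', char_of_mem (hξ.mem_domain_mul_iff.2 hξ')]
    · rw [char_of_notMem hξ', char_of_notMem (mt hξ.mem_domain_mul_iff.1 hξ')]
  · rw [transport_of_notMem hη, char_of_notMem (mt (@hsub η) hη)]

-- Without cancellation, `θ_{ww'}` acts letter by letter, first by `w'` and then by `w`, so its
-- image lies in that of `θ_w`.
open Classical in
theorem domain_mk_append_subset {w w' : List (E × Bool)} (h : FreeGroup.IsReduced (w ++ w')) :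
    Γ.domain (FreeGroup.mk (w ++ w')) ⊆ Γ.domain (FreeGroup.mk w) := by
  intro η hη
  obtain ⟨ξ, hξ⟩ := mem_domain_iff.1 hη
  rw [theta_iff_actRel, FreeGroup.toWord_mk, h.reduce_eq] at hξ
  obtain ⟨ζ, -, hζ⟩ := actRel_append.1 hξ
  refine mem_domain_iff.2 ⟨ζ, ?_⟩
  rw [theta_iff_actRel, FreeGroup.toWord_mk, (h.infix ⟨[], w', rfl⟩).reduce_eq]
  exact hζ

theorem oneDelta_congr {g h : FreeGroup E} (e : g = h) (hg : g ≠ 1) :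
    oneDelta K Γ g hg = oneDelta K Γ h (e ▸ hg) := by
  subst e; rfl

theorem oneDelta_letter_mem_range (l : E × Bool) (h : FreeGroup.mk [l] ≠ 1) :
    oneDelta K Γ (FreeGroup.mk [l]) h ∈ Set.range (toSkewRing K Γ) := by
  obtain ⟨f, _ | _⟩ := l
  · exact ⟨_, toSkewRing_ghost f⟩
  · exact ⟨_, toSkewRing_edge f⟩

theorem mk_ne_one_of_isReduced {w : List (E × Bool)} (h : FreeGroup.IsReduced w) (hw : w ≠ []) :
    FreeGroup.mk w ≠ 1 := by
  classical
  intro he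
  have := congrArg FreeGroup.toWord he
  rw [FreeGroup.toWord_mk, h.reduce_eq, FreeGroup.toWord_one] at this
  exact hw this

theorem oneDelta_mk_mem_range {w : List (E × Bool)} (hr : FreeGroup.IsReduced w)
    (h : FreeGroup.mk w ≠ 1) :
    oneDelta K Γ (FreeGroup.mk w) h ∈ Set.range (toSkewRing K Γ) := by
  induction w with
  | nil => exact absurd rfl h
  | cons l w ih =>
    rcases eq_or_ne w [] with rfl | hw
    · exact oneDelta_letter_mem_range l h
    · have hr' : FreeGroup.IsReduced w := hr.infix ⟨[l], [], by simp⟩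
      have h1 : FreeGroup.mk [l] ≠ 1 :=
        mk_ne_one_of_isReduced FreeGroup.IsReduced.singleton (List.cons_ne_nil _ _)
      have h2 := mk_ne_one_of_isReduced hr' hw
      obtain ⟨y, hy⟩ := oneDelta_letter_mem_range (K := K) (Γ := Γ) l h1
      obtain ⟨z, hz⟩ := ih hr' h2
      refine ⟨y * z, ?_⟩
      rw [map_mul, hy, hz]
      exact oneDelta_mul_oneDelta h1 h2 h (domain_mk_append_subset (w := [l]) hr)

theorem oneDelta_mem_range (g : FreeGroup E) (hg : g ≠ 1) :
    oneDelta K Γ g hg ∈ Set.range (toSkewRing K Γ) := by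
  classical
  rw [oneDelta_congr (FreeGroup.mk_toWord (x := g)).symm hg]
  exact oneDelta_mk_mem_range FreeGroup.isReduced_toWord _

/-- It suffices to reach the spanning functions: `1_v δ_1` is the image of a vertex, and `1_g δ_1`
is the product of `1_g δ_g` and `1_{g⁻¹} δ_{g⁻¹}`. -/
theorem single_one_mem_range (r : (freeGroupAction K Γ).D 1) :
    single (freeGroupAction K Γ) 1 r ∈ Set.range (toSkewRing K Γ) := by
  obtain ⟨⟨F, hF⟩, hr⟩ := r
  have hF' : F ∈ Submodule.span K (spanningSet K Γ) := hF
  induction hF' using Submodule.span_induction with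
  | mem F hF' =>
    rcases hF' with ⟨g, hg, rfl⟩ | ⟨x, rfl⟩
    · obtain ⟨y, hy⟩ := oneDelta_mem_range (K := K) (Γ := Γ) g hg
      obtain ⟨z, hz⟩ := oneDelta_mem_range (K := K) (Γ := Γ) g⁻¹ (inv_ne_one.2 hg)
      exact ⟨y * z, by rw [map_mul, hy, hz]; exact oneDelta_mul_oneDelta_inv hg⟩
    · exact ⟨_, toSkewRing_vertex x⟩
  | zero => exact ⟨0, by rw [map_zero]; exact (map_zero (single (freeGroupAction K Γ) 1)).symm⟩
  | add F F' h h' ih ih' =>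
    obtain ⟨y, hy⟩ := ih h (mem_D_one K Γ ⟨F, h⟩)
    obtain ⟨z, hz⟩ := ih' h' (mem_D_one K Γ ⟨F', h'⟩)
    exact ⟨y + z, by rw [map_add, hy, hz, ← map_add]; rfl⟩
  | smul k F h ih =>
    obtain ⟨y, hy⟩ := ih h (mem_D_one K Γ ⟨F, h⟩)
    exact ⟨k • y, by rw [map_smul, hy, ← map_smul]; rfl⟩

theorem toSkewRing_surjective : Function.Surjective (toSkewRing K Γ) := by
  intro z
  induction z using PartialAction.SkewGroupRing.induction_on with
  | h0 => exact ⟨0, map_zero _⟩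
  | hadd a b ha hb =>
    obtain ⟨a, rfl⟩ := ha
    obtain ⟨b, rfl⟩ := hb
    exact ⟨a + b, map_add _ a b⟩
  | hsingle g r =>
    rcases eq_or_ne g 1 with rfl | hg
    · exact single_one_mem_range r
    -- As `r` is supported in `X_g`, one has `r δ_g = (r δ_1)(1_g δ_g)`.
    · obtain ⟨y, hy⟩ := single_one_mem_range (K := K) (Γ := Γ) ⟨r.1, mem_D_one K Γ r.1⟩
      obtain ⟨z, hz⟩ := oneDelta_mem_range (K := K) (Γ := Γ) g hg
      refine ⟨y * z, ?_⟩
      rw [map_mul, hy, hz]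
      refine single_mul_single_eq (one_mul g) ?_
      show r.1.1 * transport K Γ 1 (char K Γ (Γ.domain g)) = r.1.1
      rw [transport_one]
      funext η
      by_cases hη : η ∈ Γ.domain g
      · rw [Pi.mul_apply, char_of_mem hη, mul_one]
      · rw [Pi.mul_apply, mem_idealD_iff.1 r.2 η hη, zero_mul]

/-! ### The canonical isomorphism and the induced grading -/

theorem isCanonicalIso_toSkewRing : IsCanonicalIso (toSkewRing K Γ) where
  bijective := ⟨LeavittPathAlgebra.toSkewRing_injective, toSkewRing_surjective⟩
  edge := toSkewRing_edge
  ghost := toSkewRing_ghost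
  vertex := toSkewRing_vertex

theorem mem_inducedGrading {φ : LeavittPathAlgebra K Γ →ₙₐ[K] SkewRing K Γ} {g : FreeGroup E}
    {x : LeavittPathAlgebra K Γ} :
    x ∈ inducedGrading φ g ↔ φ x ∈ component (freeGroupAction K Γ) g := Iff.rfl

theorem IsCanonicalIso.isGrading {φ : LeavittPathAlgebra K Γ →ₙₐ[K] SkewRing K Γ}
    (hφ : IsCanonicalIso φ) : GroupGraded.IsGrading (inducedGrading φ) where
  internal := isInternal_comap (AddEquiv.ofBijective φ hφ.bijective)
  mul_mem g h x y hx hy := by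
    rw [mem_inducedGrading] at *
    rw [map_mul]
    exact mul_mem_component hx hy

end DirectedGraph

namespace DirectedGraph

variable {V : Type u} {E : Type v} {K : Type w} [Field K] {Γ : DirectedGraph V E}

open PartialAction.SkewGroupRing

/-! ### Graphs for which the grading is strong, clean or unit-regular -/

/-- Functions in `D_g` vanish off `X_g`. Together with `mul_domainDelta_inv`, this is how the
existence of suitable elements of degree `g` forces `1_g` to be the constant `1`. -/
theorem domainDelta_mul {g : FreeGroup E} (hg : g ≠ 1) {a : SkewRing K Γ}
    (ha : a ∈ component (freeGroupAction K Γ) g) : domainDelta K Γ g hg * a = a := by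
  obtain ⟨r, rfl⟩ := ha
  refine single_mul_single_eq (one_mul g) ?_
  show char K Γ (Γ.domain g) * transport K Γ 1 r.1.1 = r.1.1
  rw [transport_one]
  funext η
  by_cases hη : η ∈ Γ.domain g
  · rw [Pi.mul_apply, char_of_mem hη, one_mul]
  · rw [Pi.mul_apply, mem_idealD_iff.1 r.2 η hη, mul_zero]

theorem mul_domainDelta_inv {g : FreeGroup E} (hg : g ≠ 1) {a : SkewRing K Γ}
    (ha : a ∈ component (freeGroupAction K Γ) g) :
    a * domainDelta K Γ g⁻¹ (inv_ne_one.2 hg) = a := by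
  obtain ⟨r, rfl⟩ := ha
  refine single_mul_single_eq (mul_one g) ?_
  show r.1.1 * transport K Γ g (char K Γ (Γ.domain g⁻¹)) = r.1.1
  rw [transport_char_self]
  funext η
  by_cases hη : η ∈ Γ.domain g
  · rw [Pi.mul_apply, char_of_mem hη, mul_one]
  · rw [Pi.mul_apply, mem_idealD_iff.1 r.2 η hη, zero_mul]

/-- Evaluate `1_g 1_v = 1_v` at a path `ξ` with `v = s(ξ)`. The vertices take the place of a unit,
which `D(X)` need not have. -/
theorem domain_eq_univ {g : FreeGroup E} (hg : g ≠ 1)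
    (h : ∀ x, domainDelta K Γ g hg * vertexDelta K Γ x = vertexDelta K Γ x) :
    Γ.domain g = Set.univ := by
  refine Set.eq_univ_of_forall fun ξ => ?_
  by_contra hξ
  have h1 : domainDelta K Γ g hg * vertexDelta K Γ ξ.source =
      single (freeGroupAction K Γ) 1 ⟨⟨char K Γ (Γ.domain g), char_domain_mem K Γ hg⟩ *
        ⟨char K Γ (Γ.vertexSet ξ.source), char_vertexSet_mem K Γ _⟩, mem_D_one K Γ _⟩ :=
    single_mul_single_eq (mul_one 1) (by rw [transport_one]; rfl)
  have h2 := single_injective _ 1 (h1.symm.trans (h ξ.source))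
  have h3 : char K Γ (Γ.domain g) * char K Γ (Γ.vertexSet ξ.source) =
      char K Γ (Γ.vertexSet ξ.source) := congrArg (fun z => z.1.1) h2
  have h4 := congrFun h3 ξ
  rw [Pi.mul_apply, char_of_notMem hξ, zero_mul,
    char_of_mem (show ξ ∈ Γ.vertexSet ξ.source from rfl)] at h4
  exact zero_ne_one h4

/-- The equality `X_{f⁻¹} = X` says that every path starts at `r(f)`, and every vertex is the source
of a path. The equality `X_f = X` says that every path begins with `f`, and every edge is the first
edge of some path. -/
theorem isLoop_of_domain_eq_univ {f : E} (h : Γ.domain (FreeGroup.of f) = Set.univ)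
    (h' : Γ.domain (FreeGroup.of f)⁻¹ = Set.univ) : Γ.IsLoop := by
  have hV : ∀ y : V, y = Γ.r f := fun y => by
    obtain ⟨ξ, rfl⟩ := BoundaryPath.exists_source_eq Γ y
    exact mem_domain_of_inv.1 (h' ▸ Set.mem_univ ξ)
  refine ⟨Γ.r f, f, hV, fun f' => ?_, hV _, rfl⟩
  obtain ⟨ξ, hξ⟩ := BoundaryPath.exists_source_eq Γ (Γ.r f')
  obtain ⟨η, hη⟩ := BoundaryPath.exists_isCons hξ
  obtain ⟨ζ, hζ⟩ := mem_domain_of.1 (h ▸ Set.mem_univ η : η ∈ Γ.domain (FreeGroup.of f))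
  exact (hη.inj hζ).1

section

variable {φ : LeavittPathAlgebra K Γ →ₙₐ[K] SkewRing K Γ}

/-- The degree of a homogeneous unit `u` is a `g` with `X_g = X`. -/
theorem IsCanonicalIso.domain_eq_univ_of_isInvertible (hφ : IsCanonicalIso φ)
    {e u : LeavittPathAlgebra K Γ} (he : GroupGraded.IsUnity e)
    (hu : GroupGraded.IsInvertible e u) {g : FreeGroup E} (hg : g ≠ 1)
    (hgu : u ∈ inducedGrading φ g) :
    Γ.domain g = Set.univ ∧ Γ.domain g⁻¹ = Set.univ := by
  obtain ⟨w, huw, hwu⟩ := hu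
  have hl : ∀ x, φ e * vertexDelta K Γ x = vertexDelta K Γ x := fun x => by
    rw [← hφ.vertex, ← map_mul, (he _).1]
  obtain ⟨y, hy⟩ := hφ.bijective.2 (domainDelta K Γ g hg)
  obtain ⟨z, hz⟩ := hφ.bijective.2 (domainDelta K Γ g⁻¹ (inv_ne_one.2 hg))
  -- Identifying `L` with its image, `1_g = 1_g (u w) = (1_g u) w = u w = e`; the other side is
  -- symmetric, with `u 1_{g⁻¹} = u`.
  have h1 : domainDelta K Γ g hg = φ e := by
    rw [← hy, ← (he y).2, map_mul φ y, ← huw, map_mul φ u, ← mul_assoc, hy,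
      domainDelta_mul hg (mem_inducedGrading.1 hgu)]
  have h2 : domainDelta K Γ g⁻¹ (inv_ne_one.2 hg) = φ e := by
    rw [← hz, ← (he z).1, map_mul φ e, ← hwu, map_mul φ w, mul_assoc, hz,
      mul_domainDelta_inv hg (mem_inducedGrading.1 hgu)]
  exact ⟨domain_eq_univ hg fun x => by rw [h1, hl],
    domain_eq_univ (inv_ne_one.2 hg) fun x => by rw [h2, hl]⟩

theorem IsCanonicalIso.edge_mem (hφ : IsCanonicalIso φ) (f : E) :
    LeavittPathAlgebra.edge K Γ f ∈ inducedGrading φ (FreeGroup.of f) := by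
  rw [mem_inducedGrading, hφ.edge]
  exact oneDelta_mem_component _ _

theorem LeavittPathAlgebra.edge_ne_zero (f : E) : LeavittPathAlgebra.edge K Γ f ≠ 0 := fun h =>
  LeavittPathAlgebra.vertex_ne_zero (K := K) (Γ := Γ) (Γ.r f) (by
    rw [← LeavittPathAlgebra.ghost_mul_edge_self, h, mul_zero])

theorem IsCanonicalIso.eq_zero_of_mem (hφ : IsCanonicalIso φ) {g h : FreeGroup E} (hgh : g ≠ h)
    {x : LeavittPathAlgebra K Γ} (hg : x ∈ inducedGrading φ g) (hh : x ∈ inducedGrading φ h) :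
    x = 0 :=
  hφ.bijective.1 ((eq_zero_of_mem_component hgh hg hh).trans (map_zero φ).symm)

/-- Every vertex lies in `L_1 = L_g L_{g⁻¹}`, and left multiplication by `1_g δ_1` fixes each
product from `L_g L_{g⁻¹}`. -/
theorem IsCanonicalIso.isLoop_of_isStronglyGraded [Nonempty E] (hφ : IsCanonicalIso φ)
    (h : GroupGraded.IsStronglyGraded (inducedGrading φ)) : Γ.IsLoop := by
  have key : ∀ g : FreeGroup E, g ≠ 1 → Γ.domain g = Set.univ := fun g hg => by
    refine domain_eq_univ (K := K) hg fun x => ?_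
    have hx : LeavittPathAlgebra.vertex K Γ x ∈ inducedGrading φ (g * g⁻¹) := by
      rw [mem_inducedGrading, hφ.vertex, mul_inv_cancel]
      exact vertexDelta_mem_component x
    rw [← h.2] at hx
    rw [← hφ.vertex]
    generalize LeavittPathAlgebra.vertex K Γ x = z at hx ⊢
    induction hx using AddSubgroup.closure_induction with
    | mem z hz =>
      obtain ⟨a, ha, b, -, rfl⟩ := hz
      rw [map_mul, ← mul_assoc, domainDelta_mul hg (mem_inducedGrading.1 ha)]
    | zero => rw [map_zero, mul_zero]
    | add a b _ _ ha hb => rw [map_add, mul_add, ha, hb]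
    | neg a _ ha => rw [map_neg, mul_neg, ha]
  obtain ⟨f⟩ := ‹Nonempty E›
  exact isLoop_of_domain_eq_univ (key _ (FreeGroup.of_ne_one f))
    (key _ (inv_ne_one.2 (FreeGroup.of_ne_one f)))

/-- Compare degrees in `f = u + a`. A nonzero homogeneous idempotent has degree `1`, since its
degree `g` satisfies `g g = g`. If `u` also had degree `1`, so would `f ≠ 0`. Hence `a` is the
coefficient of `f` at `1`, which is zero, and `f` itself is a unit. -/
theorem IsCanonicalIso.isLoop_of_isGradedClean [Nonempty E] (hφ : IsCanonicalIso φ)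
    (h : GroupGraded.IsGradedClean (inducedGrading φ)) : Γ.IsLoop := by
  obtain ⟨hA, e, he, h⟩ := h
  obtain ⟨f⟩ := ‹Nonempty E›
  have hf := hφ.edge_mem f
  obtain ⟨u, a, ⟨k, hu⟩, hue, ⟨g, hg⟩, haa, hsum⟩ := h _ ⟨_, hf⟩
  have ha1 : a ∈ inducedGrading φ 1 := by
    rcases eq_or_ne g 1 with rfl | hne
    · exact hg
    · have h2 := hA.mul_mem g g a a hg hg
      rw [haa] at h2
      rw [hφ.eq_zero_of_mem (fun e => hne (mul_eq_left.1 e)) h2 hg]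
      exact zero_mem _
  rcases eq_or_ne k 1 with rfl | hk
  · have h1 : LeavittPathAlgebra.edge K Γ f ∈ inducedGrading φ 1 := hsum ▸ add_mem hu ha1
    exact absurd (hφ.eq_zero_of_mem (FreeGroup.of_ne_one f) hf h1) (LeavittPathAlgebra.edge_ne_zero f)
  · have ha0 : a = 0 := by
      refine hφ.bijective.1 ((eq_zero_of_coeff ha1 ?_).trans (map_zero φ).symm)
      have := congrArg (fun z => coeff (freeGroupAction K Γ) 1 (φ z)) hsum
      simp only [map_add] at this
      rw [coeff_of_mem_component (FreeGroup.of_ne_one f) (mem_inducedGrading.1 hf),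
        coeff_of_mem_component hk (mem_inducedGrading.1 hu), zero_add] at this
      exact this.symm
    rw [ha0, add_zero] at hsum
    obtain ⟨h1, h2⟩ := hφ.domain_eq_univ_of_isInvertible he hue (FreeGroup.of_ne_one f)
      (hsum ▸ hf)
    exact isLoop_of_domain_eq_univ h1 h2

/-- Comparing degrees in `f = f u f` with `f ≠ 0` shows that the unit `u` has degree `f⁻¹`. -/
theorem IsCanonicalIso.isLoop_of_isGradedUnitRegular [Nonempty E] (hφ : IsCanonicalIso φ)
    (h : GroupGraded.IsGradedUnitRegular (inducedGrading φ)) : Γ.IsLoop := by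
  obtain ⟨hA, e, he, h⟩ := h
  obtain ⟨f⟩ := ‹Nonempty E›
  have hf := hφ.edge_mem f
  obtain ⟨u, ⟨g, hg⟩, hue, hx⟩ := h _ ⟨_, hf⟩
  have h1 := hA.mul_mem _ _ _ _ (hA.mul_mem _ _ _ _ hf hg) hf
  rw [← hx] at h1
  have h2 : FreeGroup.of f * g * FreeGroup.of f = FreeGroup.of f := by
    by_contra hne
    exact LeavittPathAlgebra.edge_ne_zero f (hφ.eq_zero_of_mem hne h1 hf)
  obtain rfl : g = (FreeGroup.of f)⁻¹ := eq_inv_of_mul_eq_one_right (mul_eq_right.1 h2)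
  obtain ⟨h3, h4⟩ := hφ.domain_eq_univ_of_isInvertible he hue
    (inv_ne_one.2 (FreeGroup.of_ne_one f)) hg
  rw [inv_inv] at h4
  exact isLoop_of_domain_eq_univ h4 h3

end

/-! ### The graph with one vertex and one loop -/

/-- There is no sink, so only infinite paths occur, and all their edges are the loop. -/
theorem IsLoop.subsingleton (h : Γ.IsLoop) : Subsingleton (BoundaryPath Γ) := by
  obtain ⟨x, e, hV, hE, hs, -⟩ := h
  refine ⟨fun ξ η => ?_⟩
  cases ξ with
  | finite y a hy =>
    obtain ⟨z, hz, -⟩ := hy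
    exact absurd (hs.trans (hV z).symm) (hz e)
  | infinite p hp =>
    cases η with
    | finite y a hy =>
      obtain ⟨z, hz, -⟩ := hy
      exact absurd (hs.trans (hV z).symm) (hz e)
    | infinite q hq =>
      congr 1
      funext n
      rw [hE (p n), hE (q n)]

/-- Each `θ_f` is defined at the only path and fixes it; inverses and composites then do so as well.
-/
theorem IsLoop.domain_eq_univ (h : Γ.IsLoop) (g : FreeGroup E) : Γ.domain g = Set.univ := by
  have hX := h.subsingleton
  obtain ⟨x, e, hV, hE, hs, hr⟩ := h
  have hof : ∀ (f : E) (ξ : BoundaryPath Γ), Γ.Theta (FreeGroup.of f) ξ ξ := fun f ξ => by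
    obtain ⟨η, hη⟩ := BoundaryPath.exists_isCons (f := f) (ξ := ξ)
      ((hV _).trans (hV _).symm)
    obtain rfl := Subsingleton.elim ξ η
    exact theta_of.2 hη
  refine Set.eq_univ_of_forall fun ξ => mem_domain_iff.2 ⟨ξ, ?_⟩
  induction g with
  | C1 => exact theta_one.2 rfl
  | of f => exact hof f ξ
  | inv_of f _ => exact (hof f ξ).inv
  | mul g h hg hh => exact hh.trans hg

theorem IsLoop.const_mem (h : Γ.IsLoop) (c : K) : (fun _ => c) ∈ DX K Γ := by
  obtain ⟨x, e, hV, -⟩ := h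
  have : (fun _ => c) = c • char K Γ (Γ.vertexSet x) := by
    funext ξ
    rw [Pi.smul_apply, char_of_mem (hV ξ.source), smul_eq_mul, mul_one]
  rw [this]
  exact SMulMemClass.smul_mem c (char_vertexSet_mem K Γ x)

variable (K) in
/-- The element `c δ_g` for a graph with one vertex and one loop, where `D_g = D(X) = K`. -/
noncomputable def IsLoop.monomial (h : Γ.IsLoop) (g : FreeGroup E) (c : K) : SkewRing K Γ :=
  single (freeGroupAction K Γ) g ⟨⟨fun _ => c, h.const_mem c⟩,
    mem_idealD_iff.2 fun η hη => absurd (h.domain_eq_univ g ▸ Set.mem_univ η) hη⟩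

theorem IsLoop.monomial_mem (h : Γ.IsLoop) (g : FreeGroup E) (c : K) :
    h.monomial K g c ∈ component (freeGroupAction K Γ) g := ⟨_, rfl⟩

theorem IsLoop.exists_monomial (h : Γ.IsLoop) {g : FreeGroup E} {z : SkewRing K Γ}
    (hz : z ∈ component (freeGroupAction K Γ) g) : ∃ c, z = h.monomial K g c := by
  have hX := h.subsingleton
  obtain ⟨r, rfl⟩ := hz
  obtain ⟨ξ, -⟩ := BoundaryPath.exists_source_eq Γ h.choose
  exact ⟨r.1.1 ξ, single_congr rfl (funext fun η => congrArg r.1.1 (Subsingleton.elim η ξ))⟩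

/-- Since `X_g = X`, transport fixes constants, and the product is that of the group algebra of the
infinite cyclic group `𝔽`. -/
theorem IsLoop.monomial_mul (h : Γ.IsLoop) (g g' : FreeGroup E) (c c' : K) :
    h.monomial K g c * h.monomial K g' c' = h.monomial K (g * g') (c * c') := by
  refine single_mul_single_eq rfl ?_
  funext η
  obtain ⟨ξ, hξ⟩ := mem_domain_iff.1 (h.domain_eq_univ g ▸ Set.mem_univ η : η ∈ Γ.domain g)
  rw [Pi.mul_apply, transport_apply hξ]

theorem IsLoop.monomial_zero (h : Γ.IsLoop) (g : FreeGroup E) : h.monomial K g 0 = 0 :=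
  map_zero (single (freeGroupAction K Γ) g)

theorem IsLoop.one_mul (h : Γ.IsLoop) (z : SkewRing K Γ) : h.monomial K 1 1 * z = z := by
  induction z using PartialAction.SkewGroupRing.induction_on with
  | h0 => exact mul_zero _
  | hadd a b ha hb => rw [mul_add, ha, hb]
  | hsingle g r =>
    obtain ⟨c, hc⟩ := h.exists_monomial (K := K) ⟨r, rfl⟩
    rw [hc, h.monomial_mul, _root_.one_mul, _root_.one_mul]

theorem IsLoop.mul_one (h : Γ.IsLoop) (z : SkewRing K Γ) : z * h.monomial K 1 1 = z := by
  induction z using PartialAction.SkewGroupRing.induction_on with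
  | h0 => exact zero_mul _
  | hadd a b ha hb => rw [add_mul, ha, hb]
  | hsingle g r =>
    obtain ⟨c, hc⟩ := h.exists_monomial (K := K) ⟨r, rfl⟩
    rw [hc, h.monomial_mul, _root_.mul_one, _root_.mul_one]

/-! ### Strong, clean and unit-regular gradings for the loop -/

section

variable {φ : LeavittPathAlgebra K Γ →ₙₐ[K] SkewRing K Γ}

theorem IsCanonicalIso.isStronglyGraded (hφ : IsCanonicalIso φ) (h : Γ.IsLoop) :
    GroupGraded.IsStronglyGraded (inducedGrading φ) := by
  refine ⟨hφ.isGrading, fun g g' => le_antisymm ?_ fun z hz => ?_⟩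
  · rw [AddSubgroup.closure_le]
    rintro _ ⟨x, hx, y, hy, rfl⟩
    exact hφ.isGrading.mul_mem g g' x y hx hy
  -- One product suffices: `c δ_{gg'} = (c δ_g)(1 δ_{g'})`.
  · obtain ⟨c, hc⟩ := h.exists_monomial hz
    obtain ⟨x, hx⟩ := hφ.bijective.2 (h.monomial K g c)
    obtain ⟨y, hy⟩ := hφ.bijective.2 (h.monomial K g' 1)
    refine AddSubgroup.subset_closure ⟨x, ?_, y, ?_, hφ.bijective.1 ?_⟩
    · rw [mem_inducedGrading, hx]; exact h.monomial_mem g c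
    · rw [mem_inducedGrading, hy]; exact h.monomial_mem g' 1
    · rw [map_mul, hx, hy, h.monomial_mul, mul_one]; exact hc

theorem IsCanonicalIso.exists_isUnity (hφ : IsCanonicalIso φ) (h : Γ.IsLoop) :
    ∃ e, φ e = h.monomial K 1 1 ∧ GroupGraded.IsUnity e := by
  obtain ⟨e, he⟩ := hφ.bijective.2 (h.monomial K 1 1)
  exact ⟨e, he, fun x => ⟨hφ.bijective.1 (by rw [map_mul, he, h.one_mul]),
    hφ.bijective.1 (by rw [map_mul, he, h.mul_one])⟩⟩

/-- Over a graph with one vertex and one loop, nonzero homogeneous elements have homogeneous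
inverses. -/
theorem IsCanonicalIso.exists_inverse (hφ : IsCanonicalIso φ) (h : Γ.IsLoop)
    {e : LeavittPathAlgebra K Γ} (he : φ e = h.monomial K 1 1) {x : LeavittPathAlgebra K Γ}
    (hx : GroupGraded.IsHomogeneous (inducedGrading φ) x) (hx0 : x ≠ 0) :
    ∃ w, GroupGraded.IsHomogeneous (inducedGrading φ) w ∧ x * w = e ∧ w * x = e := by
  obtain ⟨g, hg⟩ := hx
  obtain ⟨c, hc⟩ := h.exists_monomial hg
  have hc' : φ x = h.monomial K g c := hc
  have hc0 : c ≠ 0 := by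
    rintro rfl
    exact hx0 (hφ.bijective.1 (by rw [hc', h.monomial_zero, map_zero]))
  obtain ⟨w, hw⟩ := hφ.bijective.2 (h.monomial K g⁻¹ c⁻¹)
  refine ⟨w, ⟨g⁻¹, ?_⟩, hφ.bijective.1 ?_, hφ.bijective.1 ?_⟩
  · rw [mem_inducedGrading, hw]; exact h.monomial_mem _ _
  · rw [map_mul, hc', hw, h.monomial_mul, mul_inv_cancel, mul_inv_cancel₀ hc0, he]
  · rw [map_mul, hc', hw, h.monomial_mul, inv_mul_cancel, inv_mul_cancel₀ hc0, he]

theorem IsCanonicalIso.isGradedClean (hφ : IsCanonicalIso φ) (h : Γ.IsLoop) :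
    GroupGraded.IsGradedClean (inducedGrading φ) := by
  obtain ⟨e, he, hu⟩ := hφ.exists_isUnity h
  have hmem : e ∈ inducedGrading φ 1 := by
    rw [mem_inducedGrading, he]; exact h.monomial_mem _ _
  refine ⟨hφ.isGrading, e, hu, fun x hx => ?_⟩
  -- For `x = 0` use `0 = -e + e`. Any other homogeneous element is itself a unit, and the
  -- idempotent is `0`.
  rcases eq_or_ne x 0 with rfl | hx0
  · exact ⟨-e, e, ⟨1, neg_mem hmem⟩, ⟨-e, by rw [neg_mul_neg, (hu e).1],
      by rw [neg_mul_neg, (hu e).1]⟩, ⟨1, hmem⟩, (hu e).1, (neg_add_cancel e).symm⟩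
  · obtain ⟨w, -, hw⟩ := hφ.exists_inverse h he hx hx0
    exact ⟨x, 0, hx, ⟨w, hw⟩, ⟨1, zero_mem _⟩, mul_zero 0, (add_zero x).symm⟩

theorem IsCanonicalIso.isGradedUnitRegular (hφ : IsCanonicalIso φ) (h : Γ.IsLoop) :
    GroupGraded.IsGradedUnitRegular (inducedGrading φ) := by
  obtain ⟨e, he, hu⟩ := hφ.exists_isUnity h
  have hmem : e ∈ inducedGrading φ 1 := by
    rw [mem_inducedGrading, he]; exact h.monomial_mem _ _
  refine ⟨hφ.isGrading, e, hu, fun x hx => ?_⟩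
  -- For `x = 0` the unit `e` serves; otherwise `u` is the homogeneous inverse of `x`.
  rcases eq_or_ne x 0 with rfl | hx0
  · exact ⟨e, ⟨1, hmem⟩, ⟨e, (hu e).1, (hu e).1⟩, (mul_zero _).symm⟩
  · obtain ⟨w, hwh, hxw, hwx⟩ := hφ.exists_inverse h he hx hx0
    exact ⟨w, hwh, ⟨x, hwx, hxw⟩, by rw [hxw, (hu x).1]⟩

end

end DirectedGraph

/-! ### The main theorem -/

theorem theorem3p7 {V : Type u} {E : Type v} [Nonempty E] (K : Type w) [Field K]
    (Γ : DirectedGraph V E) :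
    ∃ φ : Γ.LeavittPathAlgebra K →ₙₐ[K] Γ.SkewRing K,
      DirectedGraph.IsCanonicalIso φ ∧ (∀ ψ, DirectedGraph.IsCanonicalIso ψ → ψ = φ) ∧
      GroupGraded.IsGrading (DirectedGraph.inducedGrading φ) ∧
      List.TFAE [
        GroupGraded.IsStronglyGraded (DirectedGraph.inducedGrading φ),
        GroupGraded.IsGradedClean (DirectedGraph.inducedGrading φ),
        GroupGraded.IsGradedUnitRegular (DirectedGraph.inducedGrading φ),
        Γ.IsLoop] := by
  have hφ := DirectedGraph.isCanonicalIso_toSkewRing (K := K) (Γ := Γ)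
  refine ⟨DirectedGraph.toSkewRing K Γ, hφ, fun ψ hψ => ?_, hφ.isGrading, ?_⟩
  · exact DirectedGraph.LeavittPathAlgebra.hom_ext
      (fun x => (hψ.vertex x).trans (hφ.vertex x).symm)
      (fun f => (hψ.edge f).trans (hφ.edge f).symm)
      (fun f => (hψ.ghost f).trans (hφ.ghost f).symm)
  · tfae_have 1 → 4 := hφ.isLoop_of_isStronglyGraded
    tfae_have 2 → 4 := hφ.isLoop_of_isGradedClean
    tfae_have 3 → 4 := hφ.isLoop_of_isGradedUnitRegular
    tfae_have 4 → 1 := hφ.isStronglyGraded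
    tfae_have 4 → 2 := hφ.isGradedClean
    tfae_have 4 → 3 := hφ.isGradedUnitRegular
    tfae_finish
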